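/- Let $X$ be a spacetime, that is, a smooth Hausdorff manifold with a smooth Lorentzian metric and a time orientation. For points write $p\ll q$ if there is a (piecewise smooth) future-directed timelike curve from $p$ to $q$, and for $S\subseteq X$ put $I^+(S)=\{q\mid \exists p\in S\colon p\ll q\}$ and $I^-(S)=\{p\mid \exists q\in S\colon p\ll q\}$. Let $\mathbf{Hilb}_{C_0(X)}$ be the category of Hilbert modules over $C_0(X)$ and bounded $C_0(X)$-linear maps, with tensor product $E\otimes F$ the completion of the algebraic tensor product under $\langle x\otimes y, x'\otimes y'\rangle=\langle x,x'\rangle\langle y,y'\rangle$ and tensor unit $C_0(X)$. A subunit is a subobject $s\colon S\rightarrowtail C_0(X)$ of the tensor unit; it is idempotent if $s\otimes \mathrm{id}_S\colon S\otimes S\to C_0(X)\otimes S$ is an isomorphism. For $U\subseteq X$ write $C_0(U)$ for the subunit $\{f\in C_0(X)\mid f(X\setminus U)=0\}$, and for a subunit $s$ let $\operatorname{supp}(s)=\{t\in X\mid s(x)(t)\neq 0 \text{ for some } x\in S\}$. Subunits $s,t$ are disjoint if every subunit $r$ with $r\le s$ and $r\le t$ is $0$. Then $s\mapsto C_0(I^+(\operatorname{supp}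 s))$ and $s\mapsto C_0(I^-(\operatorname{supp} s))$ define closure operators, again written $I^+$ and $I^-$, on the partially ordered set of idempotent subunits of $\mathbf{Hilb}_{C_0(X)}$, and this causal structure has complements: for every idempotent subunit $s$ with $I^+(s)=s$ (that is, $s=C_0(F)$ for a future set $F=\operatorname{supp}(s)$) there is a unique idempotent subunit $t$ with $I^-(t)=t$ that is disjoint from $s$ and such that every subunit $r$ disjoint from both $s$ and $t$ is $0$; explicitly, $t=C_0(X\setminus\overline{F})$. Moreover $t$ is the only $I^-$-closed idempotent subunit disjoint from $s$ with the formally weaker property that every idempotent subunit $r$ disjoint from both $s$ and $t$ is $0$. The same holds with $I^+$ and $I^-$ interchanged. -/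

import Mathlib

open CategoryTheory CategoryTheory.Limits
open scoped ZeroAtInfty Manifold ContDiff ComplexOrder

universe u

section HilbertModules

open scoped TensorProduct

/-- The commutative C*-algebra `C₀(X)` of continuous functions `X → ℂ` vanishing at infinity. -/
def C0 (X : Type u) [TopologicalSpace X] : Type u := C₀(X, ℂ)

namespace C0

variable {X : Type u} [TopologicalSpace X]

noncomputable instance : NonUnitalCommCStarAlgebra (C0 X) :=
  inferInstanceAs (NonUnitalCommCStarAlgebra C₀(X, ℂ))

instance : FunLike (C0 X) X ℂ := inferInstanceAs (FunLike C₀(X, ℂ) X ℂ)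

instance : ZeroAtInftyContinuousMapClass (C0 X) X ℂ :=
  inferInstanceAs (ZeroAtInftyContinuousMapClass C₀(X, ℂ) X ℂ)

@[ext] theorem ext {f g : C0 X} (h : ∀ t, f t = g t) : f = g := DFunLike.ext f g h

@[simp] theorem zero_apply (t : X) : (0 : C0 X) t = 0 := rfl
@[simp] theorem add_apply (f g : C0 X) (t : X) : (f + g) t = f t + g t := rfl
@[simp] theorem sub_apply (f g : C0 X) (t : X) : (f - g) t = f t - g t := rfl
@[simp] theorem neg_apply (f : C0 X) (t : X) : (-f) t = -f t := rfl
@[simp] theorem mul_apply (f g : C0 X) (t : X) : (f * g) t = f t * g t := rfl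
@[simp] theorem smul_apply (c : ℂ) (f : C0 X) (t : X) : (c • f) t = c * f t := rfl
@[simp] theorem star_apply (f : C0 X) (t : X) : (star f) t = star (f t) := rfl

/-- The pointwise order on `C₀(X)`: `f ≤ g` iff `f t ≤ g t` in `ℂ` (that is, `g t - f t` is a
nonnegative real number) for all `t`. -/
noncomputable instance : PartialOrder (C0 X) :=
  PartialOrder.lift (fun f => (f : X → ℂ)) DFunLike.coe_injective

theorem le_def {f g : C0 X} : f ≤ g ↔ ∀ t, f t ≤ g t := Iff.rfl

theorem norm_apply_le (f : C0 X) (t : X) : ‖f t‖ ≤ ‖f‖ :=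
  (ZeroAtInftyContinuousMap.toBCF f).norm_coe_le_norm t

theorem norm_le_of_apply {f : C0 X} {M : ℝ} (hM : 0 ≤ M) (h : ∀ t, ‖f t‖ ≤ M) : ‖f‖ ≤ M :=
  (BoundedContinuousFunction.norm_le (f := ZeroAtInftyContinuousMap.toBCF f) hM).2 h

theorem continuous_eval (t : X) : Continuous fun f : C0 X => f t :=
  (LinearMap.mkContinuous (E := C0 X) (F := ℂ) (σ := RingHom.id ℂ)
    { toFun := fun f => f t, map_add' := fun _ _ => rfl, map_smul' := fun _ _ => rfl } 1
    fun f => (norm_apply_le f t).trans (one_mul ‖f‖).ge).continuous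

theorem isClosed_nonneg : IsClosed {f : C0 X | 0 ≤ f} := by
  have : {f : C0 X | 0 ≤ f} = ⋂ t : X, {f | 0 ≤ f t} := by
    ext f; simp [le_def]
  rw [this]
  exact isClosed_iInter fun t => isClosed_Ici.preimage (continuous_eval t)

instance : StarOrderedRing (C0 X) := by
  refine StarOrderedRing.of_nonneg_iff' (fun {f g} h k t => add_le_add_right (h t) (k t)) ?_
  refine fun f => ⟨fun h => ?_, ?_⟩
  · have hf : ∀ t, f t = ((f t).re : ℂ) := fun t =>
      Complex.ext rfl (Complex.le_def.1 (h t)).2.symm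
    refine ⟨(⟨⟨fun t => ((√(f t).re : ℝ) : ℂ), ?_⟩, ?_⟩ : C₀(X, ℂ)), ?_⟩
    · have := map_continuous f
      fun_prop
    · have h0 := ((Complex.continuous_ofReal.comp
        (Real.continuous_sqrt.comp Complex.continuous_re)).tendsto 0).comp
          (ZeroAtInftyContinuousMapClass.zero_at_infty f)
      simpa [Function.comp_def] using h0
    · ext t
      change f t = star ((√(f t).re : ℝ) : ℂ) * ((√(f t).re : ℝ) : ℂ)
      rw [Complex.star_def, Complex.conj_ofReal, ← Complex.ofReal_mul,
        Real.mul_self_sqrt (Complex.le_def.1 (h t)).1, ← hf]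
  · rintro ⟨g, rfl⟩ t
    exact star_mul_self_nonneg (g t)

end C0

/-- A Hilbert module over `C₀(X)`: a complete complex normed space with a `C₀(X)`-action and a
definite positive `C₀(X)`-valued inner product, conjugate-symmetric and `C₀(X)`-linear in the second
variable, whose norm is `‖x‖ = √‖⟪x, x⟫‖`. (The module laws for the action follow from these.) -/
structure HilbMod (X : Type u) [TopologicalSpace X] : Type (u + 1) where
  carrier : Type u
  [normedAddCommGroup : NormedAddCommGroup carrier]
  [normedSpace : NormedSpace ℂ carrier]
  [smul : SMul (C0 X) carrier]
  [cstarModule : CStarModule (C0 X) carrier]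
  [completeSpace : CompleteSpace carrier]

namespace HilbMod

variable {X : Type u} [TopologicalSpace X]

instance : CoeSort (HilbMod X) (Type u) := ⟨HilbMod.carrier⟩

attribute [instance] normedAddCommGroup normedSpace smul cstarModule completeSpace

/-- Bounded `C₀(X)`-linear maps. -/
structure Hom (E F : HilbMod X) extends E.carrier →L[ℂ] F.carrier where
  map_smul₀ : ∀ (a : C0 X) (x : E), toFun (a • x) = a • toFun x

instance (E F : HilbMod X) : FunLike (Hom E F) E F where
  coe f := f.toFun
  coe_injective f g h := by
    obtain ⟨f, hf⟩ := f
    obtain ⟨g, hg⟩ := g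
    congr
    exact ContinuousLinearMap.ext (congrFun h)

@[ext] theorem Hom.ext {E F : HilbMod X} {f g : Hom E F} (h : ∀ x, f x = g x) : f = g :=
  DFunLike.ext f g h

/-- The category of Hilbert modules over `C₀(X)` and bounded `C₀(X)`-linear maps. -/
instance : Category (HilbMod X) where
  Hom := Hom
  id E := ⟨ContinuousLinearMap.id ℂ E, fun _ _ => rfl⟩
  comp f g := ⟨g.toContinuousLinearMap.comp f.toContinuousLinearMap, fun a x =>
    (congrArg g.toFun (f.map_smul₀ a x)).trans (g.map_smul₀ a _)⟩

instance (E F : HilbMod X) : FunLike (E ⟶ F) E F := inferInstanceAs (FunLike (Hom E F) E F)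

/-! ### The tensor product -/

/-- The form `⟪x ⊗ y, x' ⊗ y'⟫ = B x x' * C y y'` on an algebraic tensor product. -/
noncomputable def tensorForm {A E F : Type*} [NonUnitalCommRing A] [Module ℂ A]
    [SMulCommClass ℂ A A] [IsScalarTower ℂ A A] [AddCommGroup E] [Module ℂ E]
    [AddCommGroup F] [Module ℂ F] (B : E →ₗ⋆[ℂ] E →ₗ[ℂ] A) (C : F →ₗ⋆[ℂ] F →ₗ[ℂ] A) :
    E ⊗[ℂ] F →ₗ⋆[ℂ] E ⊗[ℂ] F →ₗ[ℂ] A :=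
  (TensorProduct.lift <| TensorProduct.mapBilinear (.id ℂ) E F A A).compr₂ (LinearMap.mul' ℂ A)
    ∘ₛₗ TensorProduct.map B C

theorem tensorForm_tmul {A E F : Type*} [NonUnitalCommRing A] [Module ℂ A]
    [SMulCommClass ℂ A A] [IsScalarTower ℂ A A] [AddCommGroup E] [Module ℂ E]
    [AddCommGroup F] [Module ℂ F] (B : E →ₗ⋆[ℂ] E →ₗ[ℂ] A) (C : F →ₗ⋆[ℂ] F →ₗ[ℂ] A)
    (x x' : E) (y y' : F) :
    tensorForm B C (x ⊗ₜ y) (x' ⊗ₜ y') = B x x' * C y y' := rfl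

section Form
variable {E F : Type*} [AddCommGroup E] [Module ℂ E] [AddCommGroup F] [Module ℂ F]

theorem form_herm (B : E →ₗ⋆[ℂ] E →ₗ[ℂ] ℂ) (hB : ∀ x, 0 ≤ B x x) (x y : E) :
    star (B x y) = B y x := by
  have h1 := hB (x + y)
  have h2 := hB (x + Complex.I • y)
  have hx := hB x
  have hy := hB y
  simp only [map_add, map_smul, LinearMap.map_smulₛₗ, LinearMap.add_apply, LinearMap.smul_apply,
    smul_eq_mul, Complex.le_def, Complex.add_im, Complex.mul_im, Complex.mul_re,
    Complex.I_re, Complex.I_im, Complex.zero_im,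
    Complex.add_re, Complex.zero_re, Complex.conj_I, Complex.neg_re, Complex.neg_im] at h1 h2 hx hy
  apply Complex.ext
  · simp; linarith [h1.2, h2.2, hx.2, hy.2]
  · simp; linarith [h1.2, h2.2, hx.2, hy.2]

theorem form_posSemidef (B : E →ₗ⋆[ℂ] E →ₗ[ℂ] ℂ) (hB : ∀ x, 0 ≤ B x x) {ι : Type*} [Fintype ι]
    (v : ι → E) : (Matrix.of fun i j => B (v i) (v j)).PosSemidef := by
  refine .of_dotProduct_mulVec_nonneg (Matrix.ext fun i j => form_herm B hB _ _) fun c => ?_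
  convert hB (∑ i, c i • v i) using 1
  simp [dotProduct, Matrix.mulVec, map_sum, LinearMap.sum_apply, Finset.mul_sum]
  rw [Finset.sum_comm]
  exact Finset.sum_congr rfl fun i _ => Finset.sum_congr rfl fun j _ => by ring

theorem tensorForm_nonneg (B : E →ₗ⋆[ℂ] E →ₗ[ℂ] ℂ) (hB : ∀ x, 0 ≤ B x x)
    (C : F →ₗ⋆[ℂ] F →ₗ[ℂ] ℂ) (hC : ∀ x, 0 ≤ C x x) (z : E ⊗[ℂ] F) : 0 ≤ tensorForm B C z z := by
  obtain ⟨S, rfl⟩ := TensorProduct.exists_finset z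
  have h := ((form_posSemidef B hB (fun i : S => i.1.1)).hadamard
    (form_posSemidef C hC (fun i : S => i.1.2))).dotProduct_mulVec_nonneg (fun _ => 1)
  convert h using 1
  rw [← Finset.sum_coe_sort]
  simp [dotProduct, Matrix.mulVec, map_sum, LinearMap.sum_apply, tensorForm_tmul]
  rw [Finset.sum_comm]

theorem form_cauchy_schwarz (B : E →ₗ⋆[ℂ] E →ₗ[ℂ] ℂ) (hB : ∀ x, 0 ≤ B x x) (x y : E) :
    ‖B x y‖ ^ 2 ≤ ‖B x x‖ * ‖B y y‖ := by
  let c : PreInnerProductSpace.Core ℂ E :=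
    { inner := fun x y => B x y
      conj_inner_symm := fun x y => form_herm B hB _ _
      re_inner_nonneg := fun x => (Complex.le_def.1 (hB x)).1
      add_left := fun x y z => by simp
      smul_left := fun x y r => by simp }
  have h := @InnerProductSpace.Core.inner_mul_inner_self_le ℂ E _ _ _ c x y
  change ‖B x y‖ * ‖B y x‖ ≤ (B x x).re * (B y y).re at h
  rw [← form_herm B hB x y, norm_star] at h
  rw [sq]
  exact h.trans (mul_le_mul (Complex.re_le_norm _) (Complex.re_le_norm _)
    ((Complex.le_def.1 (hB y)).1) (norm_nonneg _))

end Form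

/-- The inner product of a Hilbert module as a sesquilinear map. -/
noncomputable def innerₛ (E : HilbMod X) : E →ₗ⋆[ℂ] E →ₗ[ℂ] C0 X :=
  CStarModule.innerₛₗ

/-- The evaluation of a `C₀(X)`-valued form at a point. -/
noncomputable def evalForm {V : Type*} [AddCommGroup V] [Module ℂ V]
    (B : V →ₗ⋆[ℂ] V →ₗ[ℂ] C0 X) (t : X) : V →ₗ⋆[ℂ] V →ₗ[ℂ] ℂ :=
  LinearMap.mk₂'ₛₗ (starRingEnd ℂ) (RingHom.id ℂ) (fun x y => B x y t)
    (fun x y z => by simp) (fun c x y => by simp) (fun x y z => by simp) (fun c x y => by simp)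

@[simp] theorem evalForm_apply {V : Type*} [AddCommGroup V] [Module ℂ V]
    (B : V →ₗ⋆[ℂ] V →ₗ[ℂ] C0 X) (t : X) (x y : V) : evalForm B t x y = B x y t := rfl

theorem evalForm_innerₛ_nonneg (E : HilbMod X) (t : X) (x : E) :
    0 ≤ evalForm E.innerₛ t x x :=
  (CStarModule.inner_self_nonneg (A := C0 X) (x := x) :) t

theorem evalForm_tensorForm {E F : Type*} [AddCommGroup E] [Module ℂ E] [AddCommGroup F]
    [Module ℂ F] (B : E →ₗ⋆[ℂ] E →ₗ[ℂ] C0 X) (C : F →ₗ⋆[ℂ] F →ₗ[ℂ] C0 X) (t : X) :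
    evalForm (tensorForm B C) t = tensorForm (evalForm B t) (evalForm C t) := by
  refine LinearMap.ext fun z => LinearMap.ext fun w => ?_
  induction z using TensorProduct.induction_on with
  | zero => simp
  | add z z' hz hz' =>
    rw [map_add, LinearMap.map_add, LinearMap.add_apply, LinearMap.add_apply, hz, hz']
  | tmul x y =>
    induction w using TensorProduct.induction_on with
    | zero => simp
    | add z z' hz hz' => rw [map_add, LinearMap.map_add, hz, hz']
    | tmul x' y' => rfl

theorem ext_inner (E : HilbMod X) {x y : E}
    (h : ∀ z : E, inner (C0 X) z x = inner (C0 X) z y) : x = y := by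
  rw [← sub_eq_zero, ← CStarModule.inner_self (A := C0 X), CStarModule.inner_sub_right, h,
    sub_self]

/-- Multiplication by an element of `C₀(X)` as a `ℂ`-linear map. -/
def lsmul (E : HilbMod X) (a : C0 X) : E →ₗ[ℂ] E where
  toFun x := a • x
  map_add' x y := E.ext_inner fun z => by simp [mul_add]
  map_smul' c x := E.ext_inner fun z => by simp [mul_smul_comm]

/-- The algebraic tensor product over `ℂ` of two Hilbert modules, regarded as a seminormed space
under the norm of the inner product `⟪x ⊗ y, x' ⊗ y'⟫ = ⟪x, x'⟫⟪y, y'⟫`. -/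
def PreTensor (E F : HilbMod X) : Type u := E.carrier ⊗[ℂ] F.carrier

namespace PreTensor

noncomputable instance (E F : HilbMod X) : AddCommGroup (PreTensor E F) :=
  inferInstanceAs (AddCommGroup (E.carrier ⊗[ℂ] F.carrier))

noncomputable instance (E F : HilbMod X) : Module ℂ (PreTensor E F) :=
  inferInstanceAs (Module ℂ (E.carrier ⊗[ℂ] F.carrier))

variable (E F : HilbMod X)

/-- The elementary tensors. -/
noncomputable def tmul : E →ₗ[ℂ] F →ₗ[ℂ] PreTensor E F := TensorProduct.mk ℂ E.carrier F.carrier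

/-- The `C₀(X)`-valued form `⟪x ⊗ y, x' ⊗ y'⟫ = ⟪x, x'⟫⟪y, y'⟫`. -/
noncomputable def form : PreTensor E F →ₗ⋆[ℂ] PreTensor E F →ₗ[ℂ] C0 X :=
  tensorForm E.innerₛ F.innerₛ

variable {E F}

theorem induction {p : PreTensor E F → Prop} (z : PreTensor E F)
    (h : ∀ x y, p (tmul E F x y)) (hadd : ∀ z w, p z → p w → p (z + w)) : p z :=
  TensorProduct.induction_on (motive := p) z (by have := h 0 0; rwa [map_zero] at this) h hadd

theorem form_tmul (x x' : E) (y y' : F) :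
    form E F (tmul E F x y) (tmul E F x' y') =
      inner (C0 X) x x' * inner (C0 X) y y' := rfl

theorem form_apply (t : X) (z w : PreTensor E F) :
    form E F z w t = tensorForm (evalForm E.innerₛ t) (evalForm F.innerₛ t) z w :=
  DFunLike.congr_fun (DFunLike.congr_fun (evalForm_tensorForm E.innerₛ F.innerₛ t) z) w

theorem evalForm_nonneg (t : X) (z : PreTensor E F) : 0 ≤ evalForm (form E F) t z z := by
  rw [evalForm_apply, form_apply]
  exact tensorForm_nonneg _ (evalForm_innerₛ_nonneg E t) _ (evalForm_innerₛ_nonneg F t) z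

theorem form_star (z w : PreTensor E F) : star (form E F z w) = form E F w z :=
  DFunLike.ext _ _ fun t => form_herm _ (evalForm_nonneg t) z w

noncomputable instance : Norm (PreTensor E F) := ⟨fun z => √‖form E F z z‖⟩

theorem norm_sq (z : PreTensor E F) : ‖z‖ ^ 2 = ‖form E F z z‖ :=
  Real.sq_sqrt (norm_nonneg _)

theorem norm_form_le (z w : PreTensor E F) : ‖form E F z w‖ ≤ ‖z‖ * ‖w‖ := by
  have hz : 0 ≤ ‖z‖ := Real.sqrt_nonneg _
  have hw : 0 ≤ ‖w‖ := Real.sqrt_nonneg _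
  refine C0.norm_le_of_apply (mul_nonneg hz hw) fun t => ?_
  rw [← abs_of_nonneg (norm_nonneg _), ← abs_of_nonneg (mul_nonneg hz hw), ← sq_le_sq, mul_pow,
    norm_sq, norm_sq]
  exact (form_cauchy_schwarz _ (evalForm_nonneg t) z w).trans
    (mul_le_mul (C0.norm_apply_le _ t) (C0.norm_apply_le _ t) (norm_nonneg _) (norm_nonneg _))

theorem core : SeminormedSpace.Core ℂ (PreTensor E F) where
  norm_nonneg _ := Real.sqrt_nonneg _
  norm_smul c z := by
    change √‖form E F (c • z) (c • z)‖ = ‖c‖ * √‖form E F z z‖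
    simp [norm_smul, ← mul_assoc]
  norm_triangle z w := by
    have hz : 0 ≤ ‖z‖ := Real.sqrt_nonneg _
    have hw : 0 ≤ ‖w‖ := Real.sqrt_nonneg _
    refine le_of_sq_le_sq ?_ (add_nonneg hz hw)
    rw [norm_sq, map_add, map_add, LinearMap.add_apply, LinearMap.add_apply]
    have h1 := norm_form_le z w
    have h2 := norm_form_le w z
    have h3 := norm_add₃_le (a := form E F z z + form E F w z) (b := form E F z w)
      (c := form E F w w)
    have h4 := norm_add_le (form E F z z) (form E F w z)
    rw [← norm_sq] at h4
    rw [← norm_sq w] at h3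
    rw [← add_assoc]
    nlinarith

noncomputable instance : SeminormedAddCommGroup (PreTensor E F) :=
  SeminormedAddCommGroup.ofCore core

noncomputable instance : NormedSpace ℂ (PreTensor E F) where
  norm_smul_le c z := (core.norm_smul c z).le

noncomputable instance : Inner (C0 X) (PreTensor E F) := ⟨fun z w => form E F z w⟩

/-- `C₀(X)` acts on the first factor: `a • (x ⊗ y) = (a • x) ⊗ y`. -/
noncomputable def act (a : C0 X) : PreTensor E F →ₗ[ℂ] PreTensor E F :=
  TensorProduct.map (E.lsmul a) LinearMap.id

noncomputable instance : SMul (C0 X) (PreTensor E F) := ⟨fun a z => act a z⟩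

theorem smul_tmul (a : C0 X) (x : E) (y : F) :
    a • tmul E F x y = tmul E F (a • x) y := rfl

theorem form_smul_right (a : C0 X) (z w : PreTensor E F) :
    form E F z (a • w) = a * form E F z w := by
  have hadd : ∀ w w' : PreTensor E F, a • (w + w') = a • w + a • w' := map_add (act a)
  induction z using PreTensor.induction with
  | hadd z z' hz hz' => simp only [map_add, LinearMap.add_apply, hz, hz', mul_add]
  | h x y =>
    induction w using PreTensor.induction with
    | hadd z z' hz hz' => simp only [hadd, map_add, hz, hz', mul_add]
    | h x' y' => rw [smul_tmul, form_tmul, form_tmul, CStarModule.inner_op_smul_right, mul_assoc]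

theorem form_smul_left (a : C0 X) (z w : PreTensor E F) :
    form E F (a • z) w = star a * form E F z w := by
  rw [← form_star, form_smul_right, star_mul, form_star, mul_comm]

theorem norm_smul_le' (a : C0 X) (z : PreTensor E F) : ‖a • z‖ ≤ ‖a‖ * ‖z‖ := by
  refine le_of_sq_le_sq ?_ (by positivity)
  rw [norm_sq, form_smul_right, form_smul_left, mul_pow, norm_sq, sq, mul_assoc]
  refine (norm_mul_le _ _).trans ?_
  gcongr
  refine (norm_mul_le _ _).trans ?_
  rw [norm_star]

instance : UniformContinuousConstSMul (C0 X) (PreTensor E F) :=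
  ⟨fun a => ((act a).mkContinuous ‖a‖ (norm_smul_le' a)).uniformContinuous⟩

end PreTensor

section Completion

open UniformSpace UniformSpace.Completion

variable {E F : HilbMod X}

theorem tensor_inner_coe (z w : PreTensor E F) :
    inner (C0 X) (z : Completion (PreTensor E F)) (w : Completion (PreTensor E F)) =
      PreTensor.form E F z w := by
  refine (isDenseInducing_coe.prodMap isDenseInducing_coe).extend_eq
    (f := Function.uncurry (inner (C0 X) (E := PreTensor E F))) ?_ (z, w)
  let B := LinearMap.mkContinuous₂ (PreTensor.form E F) 1 (fun x y => by
    simpa using PreTensor.norm_form_le x y)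
  exact (B.continuous.comp continuous_fst).clm_apply continuous_snd

theorem tensor_continuous_inner :
    Continuous (Function.uncurry (inner (C0 X) (E := Completion (PreTensor E F)))) := by
  let inner' : PreTensor E F →+ PreTensor E F →+ C0 X :=
    { toFun := fun x => (PreTensor.form E F x).toAddMonoidHom
      map_zero' := by ext x; simp
      map_add' := fun x y => by ext z; simp }
  let B := LinearMap.mkContinuous₂ (PreTensor.form E F) 1 (fun x y => by
    simpa using PreTensor.norm_form_le x y)
  have : Continuous fun p : PreTensor E F × PreTensor E F => inner' p.1 p.2 := (B.continuous.comp continuous_fst).clm_apply continuous_snd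
  rw [Completion.toInner, inner, Function.uncurry_curry _]
  change Continuous (((isDenseInducing_toCompl (PreTensor E F)).prodMap
    (isDenseInducing_toCompl (PreTensor E F))).extend fun p => inner' p.1 p.2)
  exact (isDenseInducing_toCompl (PreTensor E F)).extend_Z_bilin
    (isDenseInducing_toCompl (PreTensor E F)) this

theorem continuous_tensor_inner {α : Type*} [TopologicalSpace α]
    {f g : α → Completion (PreTensor E F)} (hf : Continuous f) (hg : Continuous g) :
    Continuous fun a => inner (C0 X) (f a) (g a) :=
  tensor_continuous_inner.comp (hf.prodMk hg)

theorem tensor_norm_eq (z : Completion (PreTensor E F)) : ‖z‖ = √‖inner (C0 X) z z‖ :=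
  Completion.induction_on z
    (isClosed_eq continuous_norm
      (Real.continuous_sqrt.comp (continuous_tensor_inner continuous_id continuous_id).norm))
    fun a => by rw [norm_coe, tensor_inner_coe]; rfl

noncomputable instance : CStarModule (C0 X) (Completion (PreTensor E F)) where
  inner_add_right {x y z} := by
    have h1 : Continuous fun p : Completion (PreTensor E F) × Completion (PreTensor E F) ×
      Completion (PreTensor E F) => p.2.1 := continuous_fst.comp continuous_snd
    have h2 : Continuous fun p : Completion (PreTensor E F) × Completion (PreTensor E F) ×
      Completion (PreTensor E F) => p.2.2 := continuous_snd.comp continuous_snd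
    exact Completion.induction_on₃ x y z
      (isClosed_eq (continuous_tensor_inner continuous_fst (h1.add h2))
        ((continuous_tensor_inner continuous_fst h1).add
          (continuous_tensor_inner continuous_fst h2)))
      fun x y z => by rw [← coe_add, tensor_inner_coe, tensor_inner_coe, tensor_inner_coe, map_add]
  inner_self_nonneg {x} :=
    Completion.induction_on x
      (C0.isClosed_nonneg.preimage (continuous_tensor_inner continuous_id continuous_id))
      fun x => by rw [tensor_inner_coe]; exact fun t => PreTensor.evalForm_nonneg t x
  inner_self {x} := by
    rw [← norm_eq_zero, ← norm_eq_zero (a := x), tensor_norm_eq, Real.sqrt_eq_zero (norm_nonneg _)]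
  inner_op_smul_right {a x y} :=
    Completion.induction_on₂ x y
      (isClosed_eq
        (continuous_tensor_inner continuous_fst (continuous_snd.const_smul a))
        ((continuous_const_mul a).comp (continuous_tensor_inner continuous_fst continuous_snd)))
      fun x y => by rw [← coe_smul, tensor_inner_coe, tensor_inner_coe, PreTensor.form_smul_right]
  inner_smul_right_complex {c x y} :=
    Completion.induction_on₂ x y
      (isClosed_eq
        (continuous_tensor_inner continuous_fst (continuous_snd.const_smul c))
        ((continuous_tensor_inner continuous_fst continuous_snd).const_smul c))
      fun x y => by rw [← coe_smul, tensor_inner_coe, tensor_inner_coe, map_smul]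
  star_inner x y :=
    Completion.induction_on₂ x y
      (isClosed_eq (continuous_star.comp (continuous_tensor_inner continuous_fst continuous_snd))
        (continuous_tensor_inner continuous_snd continuous_fst))
      fun x y => by rw [tensor_inner_coe, tensor_inner_coe, PreTensor.form_star]
  norm_eq_sqrt_norm_inner_self := tensor_norm_eq

end Completion

/-- The tensor product `E ⊗ F` of Hilbert modules: the completion of the algebraic tensor product
under `⟪x ⊗ y, x' ⊗ y'⟫ = ⟪x, x'⟫⟪y, y'⟫`. (The tensor product is taken over `ℂ`; the completion
identifies vectors at distance `0`, and so imposes `(a • x) ⊗ y = x ⊗ (a • y)` for `a ∈ C₀(X)`,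
see `tmul_smul`.) -/
noncomputable def tensorObj (E F : HilbMod X) : HilbMod X where
  carrier := UniformSpace.Completion (PreTensor E F)

/-- The elementary tensor `x ⊗ y`. -/
noncomputable def tmul {E F : HilbMod X} (x : E) (y : F) : tensorObj E F :=
  ((PreTensor.tmul E F x y : PreTensor E F) : UniformSpace.Completion (PreTensor E F))

theorem inner_tmul {E F : HilbMod X} (x x' : E) (y y' : F) :
    inner (C0 X) (tmul x y) (tmul x' y') = inner (C0 X) x x' * inner (C0 X) y y' :=
  tensor_inner_coe _ _

theorem smul_tmul {E F : HilbMod X} (a : C0 X) (x : E) (y : F) :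
    a • tmul x y = tmul (a • x) y :=
  (UniformSpace.Completion.coe_smul a (PreTensor.tmul E F x y)).symm

theorem tmul_smul {E F : HilbMod X} (a : C0 X) (x : E) (y : F) :
    tmul (a • x) y = tmul x (a • y) := by
  refine sub_eq_zero.1 ((CStarModule.inner_self (A := C0 X)).1 ?_)
  simp only [CStarModule.inner_sub_left, CStarModule.inner_sub_right, inner_tmul,
    CStarModule.inner_op_smul_left, CStarModule.inner_op_smul_right]
  ext s
  simp only [C0.sub_apply, C0.mul_apply, C0.star_apply, C0.zero_apply]
  ring

/-- A bounded module map is bounded pointwise. -/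
theorem inner_map_le {E F : HilbMod X} (f : E ⟶ F) (t : X) (x : E) :
    (inner (C0 X) (f x) (f x) t).re ≤
      ‖f.toContinuousLinearMap‖ ^ 2 * (inner (C0 X) x x t).re := by
  have hre : ∀ s, 0 ≤ (inner (C0 X) x x s).re := fun s =>
    (Complex.le_def.1 (evalForm_innerₛ_nonneg E s x)).1
  have him : ∀ s, inner (C0 X) x x s = ((inner (C0 X) x x s).re : ℂ) := fun s =>
    Complex.ext rfl (Complex.le_def.1 (evalForm_innerₛ_nonneg E s x)).2.symm
  set p : X → ℝ := fun s => (inner (C0 X) x x s).re with hp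
  have hpc : Continuous p := Complex.continuous_re.comp (map_continuous (inner (C0 X) x x))
  set c := ‖f.toContinuousLinearMap‖ with hc
  -- multiply `x` by the function `√(δ / (p + δ))`
  have key : ∀ δ : ℝ, 0 < δ → (inner (C0 X) (f x) (f x) t).re ≤ c ^ 2 * (p t + δ) := by
    intro δ hδ
    let u : X → ℝ := fun s => √(δ / (p s + δ))
    have hu2 : ∀ s, u s ^ 2 = δ / (p s + δ) := fun s =>
      Real.sq_sqrt (div_nonneg hδ.le (add_nonneg (hre s) hδ.le))
    have huc : Continuous u := Real.continuous_sqrt.comp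
      (continuous_const.div (hpc.add continuous_const) fun s =>
        (add_pos_of_nonneg_of_pos (hre s) hδ).ne')
    let a : C0 X := (⟨⟨fun s => ((1 - u s : ℝ) : ℂ), by fun_prop⟩, by
      have h0 : Filter.Tendsto p (Filter.cocompact X) (nhds 0) := by
        have := (Complex.continuous_re.tendsto 0).comp
          (ZeroAtInftyContinuousMapClass.zero_at_infty (inner (C0 X) x x))
        exact this
      have h1 : Filter.Tendsto (fun s => ((1 - √(δ / (p s + δ)) : ℝ) : ℂ)) (Filter.cocompact X)
          (nhds ((1 - √(δ / (0 + δ)) : ℝ) : ℂ)) := by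
        refine (Complex.continuous_ofReal.tendsto _).comp (tendsto_const_nhds.sub
          ((Real.continuous_sqrt.tendsto _).comp (tendsto_const_nhds.div
            (h0.add tendsto_const_nhds) ?_)))
        simpa using hδ.ne'
      simpa [div_self hδ.ne'] using h1⟩ : C₀(X, ℂ))
    have ha : ∀ s, a s = ((1 - u s : ℝ) : ℂ) := fun s => rfl
    have hy : ∀ (G : HilbMod X) (y : G) (s : X),
        inner (C0 X) (y - a • y) (y - a • y) s = (u s : ℂ) ^ 2 * inner (C0 X) y y s := by
      intro G y s
      simp only [CStarModule.inner_sub_left, CStarModule.inner_sub_right,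
        CStarModule.inner_op_smul_left, CStarModule.inner_op_smul_right, C0.sub_apply,
        C0.mul_apply, C0.star_apply, ha]
      simp
      ring
    have hnorm : ‖x - a • x‖ ^ 2 ≤ δ := by
      rw [CStarModule.norm_sq_eq (C0 X)]
      refine C0.norm_le_of_apply hδ.le fun s => ?_
      rw [hy, him, ← Complex.ofReal_pow, ← Complex.ofReal_mul, hu2, Complex.norm_real,
        Real.norm_of_nonneg (mul_nonneg (div_nonneg hδ.le (add_nonneg (hre s) hδ.le)) (hre s)),
        div_mul_eq_mul_div]
      exact div_le_of_le_mul₀ (add_nonneg (hre s) hδ.le) hδ.le (by nlinarith [hre s])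
    have hf : f (x - a • x) = f x - a • f x :=
      (f.toContinuousLinearMap.map_sub _ _).trans (congrArg _ (f.map_smul₀ a x))
    have h1 : ‖f x - a • f x‖ ^ 2 ≤ c ^ 2 * δ := by
      rw [← hf]
      have := f.toContinuousLinearMap.le_opNorm (x - a • x)
      calc ‖f (x - a • x)‖ ^ 2 ≤ (c * ‖x - a • x‖) ^ 2 := by
            gcongr; exact this
        _ ≤ c ^ 2 * δ := by rw [mul_pow]; gcongr
    have h2 : (inner (C0 X) (f x - a • f x) (f x - a • f x) t).re ≤ c ^ 2 * δ := by
      rw [CStarModule.norm_sq_eq (C0 X)] at h1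
      exact (Complex.re_le_norm _).trans ((C0.norm_apply_le _ t).trans h1)
    rw [hy, ← Complex.ofReal_pow, Complex.re_ofReal_mul, hu2, div_mul_eq_mul_div,
      div_le_iff₀ (add_pos_of_nonneg_of_pos (hre t) hδ)] at h2
    have h3 : δ * (inner (C0 X) (f x) (f x) t).re ≤ δ * (c ^ 2 * (p t + δ)) := by
      linarith
    exact le_of_mul_le_mul_left h3 hδ
  refine le_of_forall_pos_le_add fun ε hε => ?_
  have hc2 : 0 < c ^ 2 + 1 := by positivity
  refine (key (ε / (c ^ 2 + 1)) (by positivity)).trans ?_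
  rw [mul_add]
  gcongr
  rw [← mul_div_assoc, div_le_iff₀ hc2]
  nlinarith

/-- The form `c ⟪x, y⟫(t) - ⟪f x, f y⟫(t)`. -/
noncomputable def diffForm {E F : HilbMod X} (f : E ⟶ F) (c : ℝ) (t : X) :
    E →ₗ⋆[ℂ] E →ₗ[ℂ] ℂ :=
  LinearMap.mk₂'ₛₗ (starRingEnd ℂ) (RingHom.id ℂ)
    (fun x y => c * inner (C0 X) x y t - inner (C0 X) (f x) (f y) t)
    (fun x y z => by
      have : f (x + y) = f x + f y := f.toContinuousLinearMap.map_add x y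
      simp [this]; ring)
    (fun a x y => by
      have : f (a • x) = a • f x := f.toContinuousLinearMap.map_smul a x
      simp [this]; ring)
    (fun x y z => by
      have : f (y + z) = f y + f z := f.toContinuousLinearMap.map_add y z
      simp [this]; ring)
    (fun a x y => by
      have : f (a • y) = a • f y := f.toContinuousLinearMap.map_smul a y
      simp [this]; ring)

theorem diffForm_nonneg {E F : HilbMod X} (f : E ⟶ F) (t : X) (x : E) :
    0 ≤ diffForm f (‖f.toContinuousLinearMap‖ ^ 2) t x x := by
  have h := inner_map_le f t x
  have h1 : 0 = (inner (C0 X) x x t).im := (Complex.le_def.1 (evalForm_innerₛ_nonneg E t x)).2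
  have h2 : 0 = (inner (C0 X) (f x) (f x) t).im :=
    (Complex.le_def.1 (evalForm_innerₛ_nonneg F t (f x))).2
  change 0 ≤ ((‖f.toContinuousLinearMap‖ ^ 2 : ℝ) : ℂ) * inner (C0 X) x x t
    - inner (C0 X) (f x) (f x) t
  rw [Complex.le_def]
  constructor
  · rw [Complex.sub_re, Complex.re_ofReal_mul, Complex.zero_re]; linarith
  · rw [Complex.sub_im, Complex.im_ofReal_mul, ← h1, ← h2]; simp

/-- `f ⊗ id` on the algebraic tensor product. -/
noncomputable def PreTensor.mapLeft {E F : HilbMod X} (f : E ⟶ F) (G : HilbMod X) :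
    PreTensor E G →ₗ[ℂ] PreTensor F G :=
  TensorProduct.map (f.toContinuousLinearMap : E.carrier →ₗ[ℂ] F.carrier) LinearMap.id

theorem PreTensor.mapLeft_tmul {E F : HilbMod X} (f : E ⟶ F) {G : HilbMod X} (x : E) (y : G) :
    PreTensor.mapLeft f G (PreTensor.tmul E G x y) = PreTensor.tmul F G (f x) y := rfl

theorem PreTensor.diffForm_eq {E F : HilbMod X} (f : E ⟶ F) (c : ℝ) (G : HilbMod X) (t : X)
    (z w : PreTensor E G) :
    tensorForm (diffForm f c t) (evalForm G.innerₛ t) z w =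
      c * form E G z w t - form F G (mapLeft f G z) (mapLeft f G w) t := by
  have hr : ∀ u w w' : PreTensor E G, tensorForm (diffForm f c t) (evalForm G.innerₛ t) u (w + w') =
      tensorForm (diffForm f c t) (evalForm G.innerₛ t) u w +
      tensorForm (diffForm f c t) (evalForm G.innerₛ t) u w' := fun u w w' => map_add _ w w'
  have hl : ∀ u u' w : PreTensor E G, tensorForm (diffForm f c t) (evalForm G.innerₛ t) (u + u') w =
      tensorForm (diffForm f c t) (evalForm G.innerₛ t) u w +
      tensorForm (diffForm f c t) (evalForm G.innerₛ t) u' w := fun u u' w =>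
    DFunLike.congr_fun (map_add (tensorForm (diffForm f c t) (evalForm G.innerₛ t)) u u') w
  induction z using PreTensor.induction with
  | hadd z z' hz hz' =>
    rw [hl, hz, hz']
    simp only [map_add, LinearMap.add_apply, C0.add_apply]
    ring
  | h x y =>
    induction w using PreTensor.induction with
    | hadd z z' hz hz' =>
      rw [hr, hz, hz']
      simp only [map_add, C0.add_apply]
      ring
    | h x' y' =>
      rw [mapLeft_tmul, mapLeft_tmul, form_tmul, form_tmul, C0.mul_apply, C0.mul_apply]
      change (c * inner (C0 X) x x' t - inner (C0 X) (f x) (f x') t) * inner (C0 X) y y' t = _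
      ring

theorem PreTensor.norm_mapLeft_le {E F : HilbMod X} (f : E ⟶ F) (G : HilbMod X)
    (z : PreTensor E G) : ‖mapLeft f G z‖ ≤ ‖f.toContinuousLinearMap‖ * ‖z‖ := by
  refine le_of_sq_le_sq ?_ (by positivity)
  rw [mul_pow, norm_sq, norm_sq]
  refine C0.norm_le_of_apply (by positivity) fun t => ?_
  have h := tensorForm_nonneg _ (diffForm_nonneg f t) _ (evalForm_innerₛ_nonneg G t) z
  have h' := diffForm_eq f (‖f.toContinuousLinearMap‖ ^ 2) G t z z
  have h1 := evalForm_nonneg t (mapLeft f G z)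
  rw [evalForm_apply] at h1
  rw [h', sub_nonneg] at h
  refine (CStarAlgebra.norm_le_norm_of_nonneg_of_le h1 h).trans ?_
  rw [norm_mul, Complex.norm_real, Real.norm_of_nonneg (sq_nonneg _)]
  gcongr
  exact C0.norm_apply_le _ t

theorem PreTensor.mapLeft_smul {E F : HilbMod X} (f : E ⟶ F) (G : HilbMod X) (a : C0 X)
    (z : PreTensor E G) : mapLeft f G (a • z) = a • mapLeft f G z := by
  have hadd : ∀ (H : HilbMod X) (w w' : PreTensor H G), a • (w + w') = a • w + a • w' :=
    fun _ => map_add (act a)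
  induction z using PreTensor.induction with
  | hadd z z' hz hz' => rw [hadd, map_add, map_add, hadd, hz, hz']
  | h x y =>
    rw [smul_tmul, mapLeft_tmul, mapLeft_tmul, smul_tmul]
    exact congrArg (fun x => PreTensor.tmul F G x y) (f.map_smul₀ a x)

/-- The bounded map `f ⊗ id` before completion. -/
noncomputable def PreTensor.mapLeftL {E F : HilbMod X} (f : E ⟶ F) (G : HilbMod X) :
    PreTensor E G →L[ℂ] PreTensor F G :=
  (mapLeft f G).mkContinuous ‖f.toContinuousLinearMap‖ (norm_mapLeft_le f G)

theorem PreTensor.completion_smul {E F : HilbMod X} (f : E ⟶ F) (G : HilbMod X) (a : C0 X)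
    (z : UniformSpace.Completion (PreTensor E G)) :
    (mapLeftL f G).completion (a • z) = a • (mapLeftL f G).completion z :=
  UniformSpace.Completion.induction_on z
    (isClosed_eq ((mapLeftL f G).completion.continuous.comp (continuous_const_smul a))
      ((mapLeftL f G).completion.continuous.const_smul a)) fun z => by
    rw [← UniformSpace.Completion.coe_smul, ContinuousLinearMap.completion_apply_coe,
      ContinuousLinearMap.completion_apply_coe, ← UniformSpace.Completion.coe_smul]
    exact congrArg _ (mapLeft_smul f G a z)

/-- The morphism `f ⊗ id : E ⊗ G ⟶ F ⊗ G`. -/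
noncomputable def whiskerRight {E F : HilbMod X} (f : E ⟶ F) (G : HilbMod X) :
    tensorObj E G ⟶ tensorObj F G where
  toContinuousLinearMap := (PreTensor.mapLeftL f G).completion
  map_smul₀ a z := PreTensor.completion_smul f G a z

theorem whiskerRight_tmul {E F : HilbMod X} (f : E ⟶ F) {G : HilbMod X} (x : E) (y : G) :
    whiskerRight f G (tmul x y) = tmul (f x) y :=
  ContinuousLinearMap.completion_apply_coe (PreTensor.mapLeftL f G) _

/-! ### Subunits -/

/-- The tensor unit: `C₀(X)` with `⟪f, g⟫ = f* g`, that is, with Mathlib's structure of a Hilbert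
module of a C*-algebra over itself. -/
noncomputable def tensorUnit (X : Type u) [TopologicalSpace X] : HilbMod X where
  carrier := C0 X

/-- The functions in `C₀(X)` that vanish outside `U`. -/
def vanishing (U : Set X) : Submodule ℂ (C0 X) where
  carrier := {f | ∀ t ∉ U, f t = 0}
  add_mem' {f g} hf hg t ht := by simp [hf t ht, hg t ht]
  zero_mem' t _ := rfl
  smul_mem' c f hf t ht := by simp [hf t ht]

theorem isClosed_vanishing (U : Set X) : IsClosed (vanishing U : Set (C0 X)) := by
  have : (vanishing U : Set (C0 X)) = ⋂ t ∈ Uᶜ, {f | f t = 0} := by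
    ext f; simp [vanishing]; rfl
  rw [this]
  exact isClosed_biInter fun t _ => isClosed_eq (C0.continuous_eval t) continuous_const

instance (U : Set X) : CompleteSpace (vanishing U) :=
  (isClosed_vanishing U).completeSpace_coe

noncomputable instance (U : Set X) : SMul (C0 X) (vanishing U) :=
  ⟨fun a f => ⟨a * f.1, fun t ht => by simp [f.2 t ht]⟩⟩

noncomputable instance (U : Set X) : CStarModule (C0 X) (vanishing U) where
  inner f g := star f.1 * g.1
  inner_add_right {f g h} := mul_add _ _ _
  inner_self_nonneg {f} := star_mul_self_nonneg _
  inner_self {f} := by rw [CStarRing.star_mul_self_eq_zero_iff]; exact (Subtype.ext_iff (a2 := (0 : vanishing U))).symm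
  inner_op_smul_right {a f g} := mul_left_comm _ _ _
  inner_smul_right_complex {c f g} := mul_smul_comm _ _ _
  star_inner f g := by rw [star_mul, star_star]
  norm_eq_sqrt_norm_inner_self f := by
    rw [CStarRing.norm_star_mul_self, Real.sqrt_mul_self (norm_nonneg _)]; rfl

/-- The Hilbert module `{f ∈ C₀(X) | f vanishes outside U}` (for open `U`, this is `C₀(U)`). -/
noncomputable def idealObj (U : Set X) : HilbMod X where
  carrier := vanishing U

/-- The inclusion of `idealObj U` into `C₀(X)`. -/
noncomputable def idealIncl (U : Set X) : idealObj U ⟶ tensorUnit X where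
  toContinuousLinearMap := (vanishing U).subtypeL
  map_smul₀ _ _ := rfl

theorem mono_of_injective {E F : HilbMod X} (f : E ⟶ F) (hf : Function.Injective f) : Mono f :=
  ⟨fun _ _ e => Hom.ext fun x => hf (congrArg (fun k : _ ⟶ F => k x) e)⟩

instance (U : Set X) : Mono (idealIncl U) := mono_of_injective _ Subtype.val_injective

instance : HasZeroObject (HilbMod X) := by
  have hs : Subsingleton (idealObj (∅ : Set X)) :=
    ⟨fun f g => Subtype.ext (C0.ext fun t => (f.2 t id).trans (g.2 t id).symm)⟩
  refine ⟨idealObj ∅, fun F => ⟨⟨⟨⟨0, fun a x => ?_⟩⟩, fun f => ?_⟩⟩, fun E =>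
    ⟨⟨⟨⟨0, fun a x => Subsingleton.elim _ _⟩⟩, fun f => ?_⟩⟩⟩
  · exact F.ext_inner fun z => by simp
  · exact Hom.ext fun x => by
      rw [Subsingleton.elim x 0]
      exact f.toContinuousLinearMap.map_zero.trans
        ((0 : (idealObj (∅ : Set X)).carrier →L[ℂ] F.carrier).map_zero).symm
  · exact Hom.ext fun x => Subsingleton.elim (α := idealObj (∅ : Set X)) _ _

/-- The subunit `{f ∈ C₀(X) | f vanishes outside U} ↣ C₀(X)`; for open `U` this is `C₀(U)`. -/
noncomputable def subunitOf (U : Set X) : Subobject (tensorUnit X) :=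
  Subobject.mk (idealIncl U)

/-- The set of points of `X` where some function in the image of the subunit `s` is nonzero, so
that the subunit `C₀(U)` has support `U` for open `U`. -/
def support (s : Subobject (tensorUnit X)) : Set X :=
  {t | ∃ x : (s : HilbMod X), (show C0 X from s.arrow x) t ≠ 0}

/-- A subunit `s : S ↣ I` is idempotent when `s ⊗ id : S ⊗ S ⟶ I ⊗ S` is an isomorphism. -/
def IsIdempotent (s : Subobject (tensorUnit X)) : Prop :=
  IsIso (whiskerRight s.arrow (s : HilbMod X))

end HilbMod

/-- The partially ordered set of idempotent subunits of the category of Hilbert modules. -/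
abbrev IdempotentSubunit (X : Type u) [TopologicalSpace X] : Type (u + 1) :=
  {s : Subobject (HilbMod.tensorUnit X) // HilbMod.IsIdempotent s}

/-- A causal structure: a pair of closure operators on the idempotent subunits. -/
structure CausalStructure (X : Type u) [TopologicalSpace X] where
  future : ClosureOperator (IdempotentSubunit X)
  past : ClosureOperator (IdempotentSubunit X)

end HilbertModules

section Spacetimes

/-- A smooth Lorentzian metric, with signature `(-, +, …, +)`, on a smooth `n`-manifold. -/
structure LorentzMetric (n : ℕ) (X : Type u) [TopologicalSpace X]
    [ChartedSpace (EuclideanSpace ℝ (Fin n)) X] [IsManifold (𝓡 n) ∞ X] where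
  val (x : X) : TangentSpace (𝓡 n) x →L[ℝ] TangentSpace (𝓡 n) x →L[ℝ] ℝ
  symm (x : X) (v w : TangentSpace (𝓡 n) x) : val x v w = val x w v
  /-- There is a negative vector, and the form is positive definite on its orthogonal complement. -/
  signature (x : X) : ∃ v : TangentSpace (𝓡 n) x, val x v v < 0 ∧
    ∀ w : TangentSpace (𝓡 n) x, val x v w = 0 → w ≠ 0 → 0 < val x w w
  contMDiff : ContMDiff (𝓡 n) ((𝓡 n).prod
      𝓘(ℝ, EuclideanSpace ℝ (Fin n) →L[ℝ] EuclideanSpace ℝ (Fin n) →L[ℝ] ℝ)) ∞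
    (fun x => Bundle.TotalSpace.mk'
      (EuclideanSpace ℝ (Fin n) →L[ℝ] EuclideanSpace ℝ (Fin n) →L[ℝ] ℝ) x (val x))

variable {n : ℕ} {X : Type u} [TopologicalSpace X] [ChartedSpace (EuclideanSpace ℝ (Fin n)) X]
  [IsManifold (𝓡 n) ∞ X]

/-- A time orientation, given by a continuous timelike vector field. -/
structure TimeOrientation (g : LorentzMetric n X) where
  field (x : X) : TangentSpace (𝓡 n) x
  timelike (x : X) : g.val x (field x) (field x) < 0
  continuous : Continuous fun x => (⟨x, field x⟩ : TangentBundle (𝓡 n) X)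

namespace TimeOrientation

variable {g : LorentzMetric n X} (T : TimeOrientation g)

/-- Future-directed timelike vectors: those in the same timecone as the vector field. -/
def FutureTimelike (x : X) (v : TangentSpace (𝓡 n) x) : Prop :=
  g.val x v v < 0 ∧ g.val x (T.field x) v < 0

/-- `γ` restricts to a smooth future-directed timelike curve on `[a, b]`. -/
def IsTimelikeOn (γ : ℝ → X) (a b : ℝ) : Prop :=
  ContMDiffOn 𝓘(ℝ, ℝ) (𝓡 n) ∞ γ (Set.Icc a b) ∧
    ∀ s ∈ Set.Icc a b, T.FutureTimelike (γ s)
      (mfderivWithin 𝓘(ℝ, ℝ) (𝓡 n) γ (Set.Icc a b) s (1 : ℝ))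

/-- `p ≪ q`: there is a (piecewise smooth) future-directed timelike curve from `p` to `q`, that is,
a map `γ` and points `τ 0 < τ 1 < … < τ k` such that `γ` is smooth, timelike and future-directed on
each `[τ i, τ (i + 1)]`, with `γ (τ 0) = p` and `γ (τ k) = q`. -/
def Chron (p q : X) : Prop :=
  ∃ (k : ℕ) (τ : ℕ → ℝ) (γ : ℝ → X), 0 < k ∧
    (∀ i < k, τ i < τ (i + 1) ∧ T.IsTimelikeOn γ (τ i) (τ (i + 1))) ∧ γ (τ 0) = p ∧ γ (τ k) = q

/-- The chronological future `I⁺(S)`. -/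
def chronFuture (S : Set X) : Set X := {q | ∃ p ∈ S, T.Chron p q}

/-- The chronological past `I⁻(S)`. -/
def chronPast (S : Set X) : Set X := {p | ∃ q ∈ S, T.Chron p q}

end TimeOrientation

end Spacetimes

/-! ### Continuity of the metric and openness of the timecones -/

section Causality

open Bundle Set Filter
open scoped Topology

variable {n : ℕ} {X : Type u} [TopologicalSpace X] [ChartedSpace (EuclideanSpace ℝ (Fin n)) X]
  [IsManifold (𝓡 n) ∞ X]

/-! Idempotent subunits are the same as open sets, and the claim then becomes point-set topology
with the relation `≪`.

If `s` is idempotent, the inverse of `s ⊗ id` is bounded pointwise (`inner_map_le`). Applied to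
`s(x) ⊗ x` it gives `⟪x, x⟫² ≤ K² |s(x)|² ⟪x, x⟫`, and cancelling one factor yields `‖x‖ ≤ K
‖s(x)‖`. So the image of `s` is a closed ideal of `C₀(X)`, which is determined by its support.
Conversely the inclusion of `C₀(U)` stays isometric after tensoring, and an approximate unit makes
it surjective onto `C₀(X) ⊗ C₀(U)`. Disjointness of arbitrary subunits means disjointness of
supports, because functions `a`, `b` in the two images produce a common subunit `c ↦ cab`.

For open sets the statement is this. If `F` is a future set, then `X \ closure F` is a past set: for
`p ≪ q` with `p` in the closure, the open set `I⁻(q)` meets `F`, hence `q ∈ F`. If `G` is an open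
past set disjoint from `F` with `F ∪ G` dense, then `G` misses the closure. Conversely, for `p`
outside the closure, the open set `I⁺(p) \ closure F` is nonempty, so it meets `G` and `p ∈ I⁻(G) =
G`.

This uses only that `≪` is transitive, has open futures and pasts, and relates each point to points
arbitrarily near it on both sides (`IsChronological`). The openness comes from charts: straight
segments whose direction is close to a future timelike vector are timelike near the base point
(`FutureTimelike.exists_seg`), so the ends of a timelike curve can be moved freely in a small
neighbourhood. -/

theorem LorentzMetric.continuous_apply (g : LorentzMetric n X) {M : Type*} [TopologicalSpace M]
    {b : M → X} {v w : ∀ m, TangentSpace (𝓡 n) (b m)}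
    (hv : Continuous fun m => (⟨b m, v m⟩ : TangentBundle (𝓡 n) X))
    (hw : Continuous fun m => (⟨b m, w m⟩ : TangentBundle (𝓡 n) X)) :
    Continuous fun m => g.val (b m) (v m) (w m) := by
  have h := (g.contMDiff.continuous.comp
    ((FiberBundle.continuous_proj _ _).comp hv)).clm_bundle_apply₂
    (F₁ := EuclideanSpace ℝ (Fin n)) (F₂ := EuclideanSpace ℝ (Fin n)) (F₃ := ℝ)
    (E₃ := Bundle.Trivial X ℝ) (b := b) hv hw
  refine continuous_iff_continuousAt.2 fun m => ?_
  have := h.continuousAt (x := m)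
  simp only [FiberBundle.continuousAt_totalSpace] at this
  exact this.2

namespace TimeOrientation

variable {g : LorentzMetric n X} (T : TimeOrientation g)

theorem isOpen_futureTimelike :
    IsOpen {p : TangentBundle (𝓡 n) X | T.FutureTimelike p.1 p.2} := by
  have h1 : Continuous fun p : TangentBundle (𝓡 n) X => g.val p.1 p.2 p.2 :=
    g.continuous_apply continuous_id continuous_id
  have h2 : Continuous fun p : TangentBundle (𝓡 n) X => g.val p.1 (T.field p.1) p.2 :=
    g.continuous_apply (T.continuous.comp (FiberBundle.continuous_proj _ _)) continuous_id
  exact (isOpen_lt h1 continuous_const).inter (isOpen_lt h2 continuous_const)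

theorem futureTimelike_field (x : X) : T.FutureTimelike x (T.field x) :=
  ⟨T.timelike x, T.timelike x⟩

/-- `p` and `q` are the end points of a smooth future-directed timelike curve. -/
def Seg (p q : X) : Prop :=
  ∃ (a b : ℝ) (γ : ℝ → X), a < b ∧ T.IsTimelikeOn γ a b ∧ γ a = p ∧ γ b = q

/-! ### Reparametrisation and concatenation of timelike curves -/

variable {T}

theorem IsTimelikeOn.mono {γ : ℝ → X} {a b c d : ℝ} (h : T.IsTimelikeOn γ a b) (hac : a ≤ c)
    (hdb : d ≤ b) (hcd : c < d) : T.IsTimelikeOn γ c d := by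
  have hs : Icc c d ⊆ Icc a b := Icc_subset_Icc hac hdb
  refine ⟨h.1.mono hs, fun s hs' => ?_⟩
  have := h.2 s (hs hs')
  rwa [← mfderivWithin_subset hs ((uniqueDiffOn_Icc hcd).uniqueMDiffOn s hs')
    ((h.1 s (hs hs')).mdifferentiableWithinAt (by simp))] at this

theorem futureTimelike_congr {x y : X} (h : x = y) {v : EuclideanSpace ℝ (Fin n)}
    (hv : T.FutureTimelike x v) : T.FutureTimelike y v :=
  h ▸ hv

theorem IsTimelikeOn.congr {γ γ' : ℝ → X} {a b : ℝ} (h : T.IsTimelikeOn γ a b)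
    (he : EqOn γ' γ (Icc a b)) : T.IsTimelikeOn γ' a b := by
  refine ⟨h.1.congr he, fun s hs => ?_⟩
  rw [mfderivWithin_congr he (he hs)]
  exact futureTimelike_congr (he hs).symm (h.2 s hs)

theorem IsTimelikeOn.shift {γ : ℝ → X} {a b : ℝ} (h : T.IsTimelikeOn γ a b) (c : ℝ) (hab : a < b) :
    T.IsTimelikeOn (fun t => γ (t + c)) (a - c) (b - c) := by
  have hmaps : MapsTo (fun t => t + c) (Icc (a - c) (b - c)) (Icc a b) := fun t ht =>
    ⟨by linarith [ht.1], by linarith [ht.2]⟩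
  have hab' : a - c < b - c := by linarith
  refine ⟨h.1.comp (contDiff_id.add contDiff_const).contMDiff.contMDiffOn hmaps, fun s hs => ?_⟩
  have h2 := h.2 _ (hmaps hs)
  have hd : HasMFDerivWithinAt 𝓘(ℝ, ℝ) 𝓘(ℝ, ℝ) (fun t : ℝ => t + c) (Icc (a - c) (b - c)) s
      (ContinuousLinearMap.id ℝ ℝ) :=
    ((hasFDerivAt_id s).add_const c).hasFDerivWithinAt.hasMFDerivWithinAt
  have hγ := ((h.1 _ (hmaps hs)).mdifferentiableWithinAt (by simp)).hasMFDerivWithinAt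
  have := (HasMFDerivWithinAt.comp s hγ hd hmaps.subset_preimage).mfderivWithin
    ((uniqueDiffOn_Icc hab').uniqueMDiffOn s hs)
  change T.FutureTimelike (γ (s + c)) (mfderivWithin 𝓘(ℝ, ℝ) (𝓡 n) (γ ∘ fun t => t + c)
    (Icc (a - c) (b - c)) s (1 : ℝ))
  rw [this]
  exact h2

theorem Seg.chron {p q : X} (h : T.Seg p q) : T.Chron p q := by
  obtain ⟨a, b, γ, hab, hγ, ha, hb⟩ := h
  refine ⟨1, fun i => if i = 0 then a else b, γ, one_pos, fun i hi => ?_, by simpa, by simpa⟩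
  obtain rfl : i = 0 := by omega
  simpa using ⟨hab, hγ⟩

theorem Chron.trans_seg {p q r : X} (h : T.Chron p q) (h' : T.Seg q r) : T.Chron p r := by
  obtain ⟨k, τ, γ, hk, hτ, h0, h1⟩ := h
  obtain ⟨a, b, γ', hab, hγ', ha, hb⟩ := h'
  -- The glued curve is split at `τ k`, so all the old pieces must lie to its left.
  have hle : ∀ i ≤ k, τ i ≤ τ k := fun i hi => by
    induction hi using Nat.decreasingInduction with
    | self => rfl
    | of_succ j hj ih => exact (hτ j hj).1.le.trans ih
  -- One node is added, and `γ'` is translated so that its parameter `a` sits at `τ k`.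
  refine ⟨k + 1, fun i => if i ≤ k then τ i else τ k + (b - a),
    fun t => if t ≤ τ k then γ t else γ' (t + (a - τ k)), by omega, fun i hi => ?_,
    by simpa [hle 0 (Nat.zero_le k)], ?_⟩
  all_goals beta_reduce
  · rcases Nat.lt_succ_iff_lt_or_eq.1 hi with hi | rfl
    · rw [if_pos hi.le, if_pos (show i + 1 ≤ k from hi)]
      refine ⟨(hτ i hi).1, (hτ i hi).2.congr fun t ht => ?_⟩
      exact if_pos (ht.2.trans (hle _ hi))
    · rw [if_pos le_rfl, if_neg (by omega)]
      refine ⟨by linarith, ?_⟩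
      have := hγ'.shift (a - τ i) hab
      rw [show a - (a - τ i) = τ i by ring, show b - (a - τ i) = τ i + (b - a) by ring] at this
      refine this.congr fun t ht => ?_
      -- At the joint itself the glued curve is defined by `γ`; both curves pass through `q` there.
      rcases ht.1.eq_or_lt with rfl | hlt
      · simp [h1, ha]
      · exact if_neg hlt.not_ge
  · rw [if_neg (Nat.not_succ_le_self k), if_neg (by linarith), ← hb]
    congr 1; ring

/-- In this form transitivity is immediate, and openness concerns only the first or last segment of
a chain. -/
theorem chron_iff_transGen {p q : X} : T.Chron p q ↔ Relation.TransGen T.Seg p q := by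
  constructor
  · rintro ⟨k, τ, γ, hk, hτ, rfl, rfl⟩
    obtain ⟨k, rfl⟩ := Nat.exists_eq_succ_of_ne_zero hk.ne'
    clear hk
    have hseg : ∀ i < k + 1, T.Seg (γ (τ i)) (γ (τ (i + 1))) := fun i hi =>
      ⟨_, _, γ, (hτ i hi).1, (hτ i hi).2, rfl, rfl⟩
    clear hτ
    induction k with
    | zero => exact .single (hseg 0 one_pos)
    | succ k ih => exact (ih fun i hi => hseg i (by omega)).tail (hseg _ (by omega))
  · intro h
    induction h with
    | single h => exact h.chron
    | tail _ h' ih => exact ih.trans_seg h'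

theorem Chron.trans {p q r : X} (h : T.Chron p q) (h' : T.Chron q r) : T.Chron p r := by
  rw [chron_iff_transGen] at *
  exact h.trans h'

/-- In the chart at `q`, vectors close to a future timelike vector at `q` are future timelike at
points close to `q`. -/
theorem FutureTimelike.exists_ball {q : X} {v : EuclideanSpace ℝ (Fin n)}
    (hv : T.FutureTimelike q v) : ∃ δ > 0,
      Metric.ball (extChartAt (𝓡 n) q q) δ ⊆ (extChartAt (𝓡 n) q).target ∧
      ∀ u ∈ Metric.ball (extChartAt (𝓡 n) q q) δ, ∀ w ∈ Metric.ball v δ,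
        T.FutureTimelike ((extChartAt (𝓡 n) q).symm u)
          ((trivializationAt (EuclideanSpace ℝ (Fin n)) (TangentSpace (𝓡 n)) q).symm
            ((extChartAt (𝓡 n) q).symm u) w) := by
  set φ := extChartAt (𝓡 n) q with hφ
  set e := trivializationAt (EuclideanSpace ℝ (Fin n)) (TangentSpace (𝓡 n) : X → Type _) q with he
  have hbase : e.baseSet = φ.source := by
    rw [he, TangentBundle.trivializationAt_baseSet, hφ, extChartAt_source]
  -- `ψ` is the tangent bundle in coordinates: being continuous, it pulls the open set of future
  -- timelike vectors back to a neighbourhood of `(φ q, v)`.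
  let ψ : EuclideanSpace ℝ (Fin n) × EuclideanSpace ℝ (Fin n) → TangentBundle (𝓡 n) X :=
    fun p => e.toOpenPartialHomeomorph.symm (φ.symm p.1, p.2)
  have hopen : IsOpen (φ.target ×ˢ (univ : Set (EuclideanSpace ℝ (Fin n)))) :=
    (isOpen_extChartAt_target q).prod isOpen_univ
  have hψ : ContinuousOn ψ (φ.target ×ˢ univ) := by
    refine e.toOpenPartialHomeomorph.symm.continuousOn.comp ?_ ?_
    · exact ((continuousOn_extChartAt_symm q).comp continuousOn_fst fun p hp => hp.1).prodMk
        continuousOn_snd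
    · intro p hp
      change _ ∈ e.target
      rw [e.mem_target, hbase]
      exact φ.map_target hp.1
  have hval : ∀ u ∈ φ.target, ∀ w, ψ (u, w) = ⟨φ.symm u, e.symm (φ.symm u) w⟩ := fun u hu w =>
    (e.mk_symm (by rw [hbase]; exact φ.map_target hu) w).symm
  have hq : (φ q, v) ∈ φ.target ×ˢ (univ : Set (EuclideanSpace ℝ (Fin n))) :=
    ⟨mem_extChartAt_target q, mem_univ _⟩
  have hψq : ψ (φ q, v) = ⟨q, v⟩ := by
    change e.toOpenPartialHomeomorph.symm (φ.symm (φ q), v) = _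
    rw [hφ, extChartAt_to_inv, ← e.mk_symm (by rw [hbase]; exact mem_extChartAt_source q)]
    congr 1
    -- Over its own centre `q` the trivialisation is the identity of the tangent space.
    rw [← e.symmL_apply (R := ℝ) (by rw [hbase]; exact mem_extChartAt_source q),
      TangentBundle.symmL_trivializationAt_eq_core (mem_chart_source _ q)]
    exact (tangentBundleCore (𝓡 n) X).coordChange_self (achart _ q) q (mem_chart_source _ q) v
  have hnhds : (φ.target ×ˢ univ) ∩ ψ ⁻¹' {p | T.FutureTimelike p.1 p.2} ∈ 𝓝 (φ q, v) :=
    (hψ.isOpen_inter_preimage hopen T.isOpen_futureTimelike).mem_nhds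
      ⟨hq, by rw [mem_preimage, hψq]; exact hv⟩
  have hfut : ∀ p ∈ (φ.target ×ˢ univ) ∩ ψ ⁻¹' {p | T.FutureTimelike p.1 p.2},
      p.1 ∈ φ.target ∧ T.FutureTimelike (φ.symm p.1) (e.symm (φ.symm p.1) p.2) := by
    rintro ⟨u, w⟩ ⟨hu, hp⟩
    rw [mem_preimage, hval u hu.1] at hp
    exact ⟨hu.1, hp⟩
  generalize (φ.target ×ˢ univ) ∩ ψ ⁻¹' {p | T.FutureTimelike p.1 p.2} = S at hnhds hfut
  obtain ⟨δ, hδ, hb⟩ := Metric.mem_nhds_iff.1 hnhds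
  have key : ∀ u ∈ Metric.ball (φ q) δ, ∀ w ∈ Metric.ball v δ, (u, w) ∈ S := fun u hu w hw =>
    hb (by rw [← ball_prod_same]; exact ⟨hu, hw⟩)
  exact ⟨δ, hδ, fun u hu => (hfut _ (key u hu v (Metric.mem_ball_self hδ))).1,
    fun u hu w hw => (hfut _ (key u hu w hw)).2⟩

/-- In the chart at `q`, segments close to `φ q` and of direction close to a future timelike vector
are future timelike. -/
theorem FutureTimelike.exists_seg {q : X} {v : EuclideanSpace ℝ (Fin n)}
    (hv : T.FutureTimelike q v) : ∃ δ > 0,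
      ∀ y ∈ Metric.ball (extChartAt (𝓡 n) q q) δ, ∀ z ∈ Metric.ball (extChartAt (𝓡 n) q q) δ,
      ∀ h > 0, ‖z - y - h • v‖ < δ * h →
        T.Seg ((extChartAt (𝓡 n) q).symm y) ((extChartAt (𝓡 n) q).symm z) := by
  obtain ⟨δ, hδ, hsub, hball⟩ := hv.exists_ball
  refine ⟨δ, hδ, fun y hy z hz h hh hyz => ?_⟩
  set φ := extChartAt (𝓡 n) q with hφ
  -- The constant velocity of the segment from `y` to `z` run over time `h`; the hypothesis says
  -- that it is within `δ` of `v`.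
  set w := h⁻¹ • (z - y) with hw
  have hhw : h • w = z - y := smul_inv_smul₀ hh.ne' _
  have hwv : w ∈ Metric.ball v δ := by
    rw [mem_ball_iff_norm, ← mul_lt_mul_iff_left₀ hh]
    refine lt_of_eq_of_lt ?_ hyz
    rw [← hhw, ← smul_sub, norm_smul, Real.norm_of_nonneg hh.le, mul_comm]
  have hline : ∀ s ∈ Icc 0 h, y + s • w ∈ Metric.ball (φ q) δ := fun s hs => by
    have := (convex_ball (φ q) δ).add_smul_sub_mem hy hz (t := s / h)
      ⟨div_nonneg hs.1 hh.le, div_le_one_of_le₀ hs.2 hh.le⟩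
    rwa [← hhw, smul_smul, div_mul_cancel₀ _ hh.ne'] at this
  refine ⟨0, h, fun s => φ.symm (y + s • w), hh, ⟨?_, fun s hs => ?_⟩, by simp, by simp [hhw]⟩
  · refine (contMDiffOn_extChartAt_symm q).comp (t := φ.target) (ContDiff.contMDiff ?_).contMDiffOn
      fun s hs => hsub (hline s hs)
    fun_prop
  · have hd : HasMFDerivWithinAt 𝓘(ℝ, ℝ) 𝓘(ℝ, EuclideanSpace ℝ (Fin n)) (fun t : ℝ => y + t • w)
        (Icc 0 h) s ((ContinuousLinearMap.id ℝ ℝ).smulRight w) :=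
      (((hasFDerivAt_id s).smul_const w).const_add y).hasFDerivWithinAt.hasMFDerivWithinAt
    have hφd := (mdifferentiableWithinAt_extChartAt_symm (I := 𝓡 n)
      (hsub (hline s hs))).hasMFDerivWithinAt
    have := (HasMFDerivWithinAt.comp s hφd hd fun t _ => by simp).mfderivWithin
      ((uniqueDiffOn_Icc hh).uniqueMDiffOn s hs)
    change T.FutureTimelike (φ.symm (y + s • w)) (mfderivWithin 𝓘(ℝ, ℝ) (𝓡 n)
      (φ.symm ∘ fun t => y + t • w) (Icc 0 h) s (1 : ℝ))
    rw [this]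
    have hs' := hball _ (hline s hs) w hwv
    have hsrc : φ.symm (y + s • w) ∈ (chartAt (EuclideanSpace ℝ (Fin n)) q).source := by
      rw [← extChartAt_source (𝓡 n)]; exact φ.map_target (hsub (hline s hs))
    -- The inverse trivialisation is the derivative of `φ.symm`, so the vector controlled by `hball`
    -- is the velocity of the curve.
    rw [← Trivialization.symmL_apply (R := ℝ) _ hsrc,
      TangentBundle.symmL_trivializationAt hsrc, ← hφ, φ.right_inv (hsub (hline s hs))] at hs'
    convert! hs' using 1
    change mfderivWithin _ _ _ _ _ ((1 : ℝ) • w) = _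
    rw [one_smul]
    rfl

/-- The manifold derivative at `c` is read in the chart centred at `γ c`, so no change of
coordinates intervenes. -/
theorem IsTimelikeOn.exists_hasDerivWithinAt {γ : ℝ → X} {a b c : ℝ} (hγ : T.IsTimelikeOn γ a b)
    (hc : c ∈ Icc a b) : ∃ v : EuclideanSpace ℝ (Fin n), T.FutureTimelike (γ c) v ∧
      HasDerivWithinAt (extChartAt (𝓡 n) (γ c) ∘ γ) v (Icc a b) c := by
  have hd := ((hγ.1 c hc).mdifferentiableWithinAt (by simp)).hasMFDerivWithinAt
  have hv := hγ.2 c hc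
  generalize mfderivWithin 𝓘(ℝ, ℝ) (𝓡 n) γ (Icc a b) c = L at hd hv
  refine ⟨L (1 : ℝ), hv, ?_⟩
  have := hd.2
  simp only [writtenInExtChartAt, mfld_simps] at this
  exact HasFDerivWithinAt.hasDerivWithinAt (f' := L) this

/-- Points of a timelike curve near `γ c`, and points of `X` near `γ c`, are joined by timelike
segments. -/
theorem IsTimelikeOn.eventually_seg {γ : ℝ → X} {a b c : ℝ} (hγ : T.IsTimelikeOn γ a b)
    (hc : c ∈ Icc a b) : ∀ᶠ s in 𝓝[Icc a b] c, ∀ᶠ x in 𝓝 (γ c),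
      (s < c → T.Seg (γ s) x) ∧ (c < s → T.Seg x (γ s)) := by
  obtain ⟨v, hv, hder⟩ := hγ.exists_hasDerivWithinAt hc
  obtain ⟨δ, hδ, hseg⟩ := hv.exists_seg
  set φ := extChartAt (𝓡 n) (γ c) with hφ
  have hball : Metric.ball (φ (γ c)) δ ∈ 𝓝 (φ (γ c)) := Metric.ball_mem_nhds _ hδ
  -- Of the tolerance `δ |s - c|`, half pays for the linearisation error of `γ` and half for the
  -- displacement of `x` from `γ c`. The neighbourhood of `x` therefore shrinks with `s`.
  filter_upwards [(hasDerivWithinAt_iff_isLittleO.1 hder).def (half_pos hδ),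
    hder.continuousWithinAt.eventually hball,
    (hγ.1 c hc).continuousWithinAt.eventually (extChartAt_source_mem_nhds (I := 𝓡 n) (γ c))]
    with s hs1 hs2 hs3
  rcases eq_or_ne s c with rfl | hsc
  · exact .of_forall fun x => ⟨fun h => (lt_irrefl _ h).elim, fun h => (lt_irrefl _ h).elim⟩
  have hpos : 0 < |s - c| := abs_pos.2 (sub_ne_zero.2 hsc)
  filter_upwards [(continuousAt_extChartAt (I := 𝓡 n) (γ c)).eventually hball,
    (continuousAt_extChartAt (I := 𝓡 n) (γ c)).eventually
      (Metric.ball_mem_nhds _ (mul_pos (half_pos hδ) hpos)),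
    extChartAt_source_mem_nhds (I := 𝓡 n) (γ c)] with x hx1 hx2 hx3
  rw [dist_eq_norm] at hx2
  simp only [Function.comp_apply, Real.norm_eq_abs, ← hφ] at hs1 hs2 hx2
  have hγs : φ.symm (φ (γ s)) = γ s := φ.left_inv hs3
  have hxx : φ.symm (φ x) = x := φ.left_inv hx3
  refine ⟨fun hlt => ?_, fun hlt => ?_⟩
  · have := hseg (φ (γ s)) hs2 (φ x) hx1 (c - s) (sub_pos.2 hlt) ?_
    · rwa [hγs, hxx] at this
    · have he : φ x - φ (γ s) - (c - s) • v =
          (φ x - φ (γ c)) - (φ (γ s) - φ (γ c) - (s - c) • v) := by module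
      rw [abs_of_neg (sub_neg.2 hlt), neg_sub] at hs1 hx2
      rw [he]
      linarith [norm_sub_le (φ x - φ (γ c)) (φ (γ s) - φ (γ c) - (s - c) • v)]
  · have := hseg (φ x) hx1 (φ (γ s)) hs2 (s - c) (sub_pos.2 hlt) ?_
    · rwa [hγs, hxx] at this
    · have he : φ (γ s) - φ x - (s - c) • v =
          (φ (γ s) - φ (γ c) - (s - c) • v) - (φ x - φ (γ c)) := by module
      rw [abs_of_pos (sub_pos.2 hlt)] at hs1 hx2
      rw [he]
      linarith [norm_sub_le (φ (γ s) - φ (γ c) - (s - c) • v) (φ x - φ (γ c))]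

/-- Take `r` on the curve shortly before its end; it reaches a whole neighbourhood of `q`. -/
theorem Seg.exists_eventually_seg_right {p q : X} (hpq : T.Seg p q) :
    ∃ r, T.Seg p r ∧ ∀ᶠ q' in 𝓝 q, T.Seg r q' := by
  obtain ⟨a, b, γ, hab, hγ, rfl, rfl⟩ := hpq
  have h := (hγ.eventually_seg (right_mem_Icc.2 hab.le)).filter_mono
    (nhdsWithin_mono b Ioo_subset_Icc_self)
  have : (𝓝[Ioo a b] b).NeBot := right_nhdsWithin_Ioo_neBot hab
  obtain ⟨s, hs, hs'⟩ := (h.and self_mem_nhdsWithin).exists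
  exact ⟨γ s, ⟨a, s, γ, hs'.1, hγ.mono le_rfl hs'.2.le hs'.1, rfl, rfl⟩,
    hs.mono fun x hx => hx.1 hs'.2⟩

theorem Seg.exists_eventually_seg_left {p q : X} (hpq : T.Seg p q) :
    ∃ r, T.Seg r q ∧ ∀ᶠ p' in 𝓝 p, T.Seg p' r := by
  obtain ⟨a, b, γ, hab, hγ, rfl, rfl⟩ := hpq
  have h := (hγ.eventually_seg (left_mem_Icc.2 hab.le)).filter_mono
    (nhdsWithin_mono a Ioo_subset_Icc_self)
  have : (𝓝[Ioo a b] a).NeBot := left_nhdsWithin_Ioo_neBot hab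
  obtain ⟨s, hs, hs'⟩ := (h.and self_mem_nhdsWithin).exists
  exact ⟨γ s, ⟨s, b, γ, hs'.2, hγ.mono hs'.1.le le_rfl hs'.2, rfl, rfl⟩,
    hs.mono fun x hx => hx.2 hs'.1⟩

variable (T) in
-- Move from `x` along `± h • v` in the chart, with `v` the time orientation at `x`; the direction
-- is exact, so the error allowed by `exists_seg` is not even needed.
theorem exists_seg_mem {x : X} {W : Set X} (hW : W ∈ 𝓝 x) :
    (∃ y ∈ W, T.Seg x y) ∧ ∃ y ∈ W, T.Seg y x := by
  obtain ⟨δ, hδ, hseg⟩ := (T.futureTimelike_field x).exists_seg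
  set φ := extChartAt (𝓡 n) x with hφ
  let v : EuclideanSpace ℝ (Fin n) := T.field x
  have hx : φ.symm (φ x) = x := extChartAt_to_inv x
  have hS : Metric.ball (φ x) δ ∩ φ.symm ⁻¹' W ∈ 𝓝 (φ x) :=
    inter_mem (Metric.ball_mem_nhds _ hδ)
      ((continuousAt_extChartAt_symm x).preimage_mem_nhds (by rwa [← hφ, hx]))
  have h1 : Tendsto (fun h : ℝ => φ x + h • v) (𝓝[>] 0) (𝓝 (φ x)) := by
    have : Continuous fun h : ℝ => φ x + h • v := by fun_prop
    simpa using (this.tendsto 0).mono_left nhdsWithin_le_nhds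
  have h2 : Tendsto (fun h : ℝ => φ x - h • v) (𝓝[>] 0) (𝓝 (φ x)) := by
    have : Continuous fun h : ℝ => φ x - h • v := by fun_prop
    simpa using (this.tendsto 0).mono_left nhdsWithin_le_nhds
  obtain ⟨h, ⟨hh1, hh2⟩, hpos : 0 < h⟩ :=
    (((h1.eventually hS).and (h2.eventually hS)).and self_mem_nhdsWithin).exists
  refine ⟨⟨_, hh1.2, ?_⟩, _, hh2.2, ?_⟩
  · have := hseg (φ x) (Metric.mem_ball_self hδ) _ hh1.1 h hpos ?_
    · rwa [hx] at this
    · rw [add_sub_cancel_left]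
      change ‖h • v - h • v‖ < _
      rw [sub_self, norm_zero]
      exact mul_pos hδ hpos
  · have := hseg _ hh2.1 (φ x) (Metric.mem_ball_self hδ) h hpos ?_
    · rwa [hx] at this
    · rw [sub_sub_cancel]
      change ‖h • v - h • v‖ < _
      rw [sub_self, norm_zero]
      exact mul_pos hδ hpos

/-- Split the last segment of the chain at a point that reaches every `q'` near `q`. -/
theorem isOpen_setOf_chron_right (p : X) : IsOpen {q | T.Chron p q} := by
  refine isOpen_iff_mem_nhds.2 fun q hq => ?_
  obtain ⟨p', hp', hq⟩ := Relation.TransGen.tail'_iff.1 (chron_iff_transGen.1 hq)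
  obtain ⟨r, hr, hev⟩ := hq.exists_eventually_seg_right
  filter_upwards [hev] with q' hq'
  exact chron_iff_transGen.2 ((Relation.TransGen.tail' hp' hr).tail hq')

theorem isOpen_setOf_chron_left (q : X) : IsOpen {p | T.Chron p q} := by
  refine isOpen_iff_mem_nhds.2 fun p hp => ?_
  obtain ⟨p', hp, hp'⟩ := Relation.TransGen.head'_iff.1 (chron_iff_transGen.1 hp)
  obtain ⟨r, hr, hev⟩ := hp.exists_eventually_seg_left
  filter_upwards [hev] with q' hq'
  exact chron_iff_transGen.2 ((Relation.TransGen.head' hr hp').head hq')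

end TimeOrientation

/-- The points that follow some point of `S` under `R`. -/
def relFuture {X : Type*} (R : X → X → Prop) (S : Set X) : Set X := {q | ∃ p ∈ S, R p q}

/-- The properties shared by the relations `p ≪ q` and `q ≪ p` of a spacetime. -/
structure IsChronological {X : Type*} [TopologicalSpace X] (R : X → X → Prop) : Prop where
  trans {p q r : X} : R p q → R q r → R p r
  isOpen_right (p : X) : IsOpen {q | R p q}
  isOpen_left (q : X) : IsOpen {p | R p q}
  exists_right (x : X) {W : Set X} : W ∈ 𝓝 x → ∃ y ∈ W, R x y
  exists_left (x : X) {W : Set X} : W ∈ 𝓝 x → ∃ y ∈ W, R y x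

theorem TimeOrientation.isChronological {g : LorentzMetric n X} (T : TimeOrientation g) :
    IsChronological T.Chron where
  trans := Chron.trans
  isOpen_right := isOpen_setOf_chron_right
  isOpen_left := isOpen_setOf_chron_left
  exists_right _ _ hW := (T.exists_seg_mem hW).1.imp fun _ h => ⟨h.1, h.2.chron⟩
  exists_left _ _ hW := (T.exists_seg_mem hW).2.imp fun _ h => ⟨h.1, h.2.chron⟩

namespace IsChronological

variable {X : Type*} [TopologicalSpace X] {R : X → X → Prop}

theorem swap (h : IsChronological R) : IsChronological (Function.swap R) where
  trans h1 h2 := h.trans h2 h1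
  isOpen_right := h.isOpen_left
  isOpen_left := h.isOpen_right
  exists_right := h.exists_left
  exists_left := h.exists_right

theorem isOpen_relFuture (h : IsChronological R) (S : Set X) : IsOpen (relFuture R S) := by
  have : relFuture R S = ⋃ p ∈ S, {q | R p q} := by ext; simp [relFuture]
  rw [this]
  exact isOpen_biUnion fun p _ => h.isOpen_right p

/-- An open set contains a predecessor of each of its points. -/
theorem subset_relFuture (h : IsChronological R) {S : Set X} (hS : IsOpen S) :
    S ⊆ relFuture R S := fun x hx => h.exists_left x (hS.mem_nhds hx)

theorem relFuture_relFuture (h : IsChronological R) {S : Set X} :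
    relFuture R (relFuture R S) = relFuture R S := by
  refine Subset.antisymm ?_ (h.subset_relFuture (h.isOpen_relFuture S))
  rintro r ⟨q, ⟨p, hp, hpq⟩, hqr⟩
  exact ⟨p, hp, h.trans hpq hqr⟩

/-- The exterior of a future set is a past set. -/
theorem relFuture_swap_compl_closure (h : IsChronological R) {F : Set X}
    (hF : relFuture R F = F) :
    relFuture (Function.swap R) (closure F)ᶜ = (closure F)ᶜ := by
  refine Subset.antisymm ?_ (h.swap.subset_relFuture isClosed_closure.isOpen_compl)
  rintro p ⟨q, hq, hpq : R p q⟩ hp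
  -- The past of `q` is an open neighbourhood of `p`, a point of the closure, so it meets `F`.
  obtain ⟨f, hfq, hf⟩ := mem_closure_iff.1 hp _ (h.isOpen_left q) hpq
  exact hq (subset_closure (hF ▸ ⟨f, hf, hfq⟩ : q ∈ F))

/-- A past set that is disjoint from an open set `F` and whose union with `F` is dense is the
exterior of `F`. -/
theorem eq_compl_closure (h : IsChronological R) {F G : Set X} (hGo : IsOpen G)
    (hG : relFuture (Function.swap R) G = G) (hFG : Disjoint F G) (hd : Dense (F ∪ G)) :
    G = (closure F)ᶜ := by
  refine Subset.antisymm (subset_compl_comm.1 ?_) fun p hp => ?_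
  · exact closure_minimal hFG.subset_compl_right hGo.isClosed_compl
  · have hW : IsOpen (closure F)ᶜ := isClosed_closure.isOpen_compl
    -- A successor of `p` outside `closure F` makes the open set tested against density nonempty.
    obtain ⟨q, hq, hpq⟩ := h.exists_right p (hW.mem_nhds hp)
    obtain ⟨r, ⟨hrW, hpr⟩, hr⟩ :=
      hd.inter_open_nonempty _ (hW.inter (h.isOpen_right p)) ⟨q, hq, hpq⟩
    rcases hr with hr | hr
    · exact (hrW (subset_closure hr)).elim
    · rw [← hG]; exact ⟨r, hr, hpr⟩

end IsChronological

end Causality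

/-! ### Closed ideals of `C₀(X)`, and supports of subunits -/

section Subunits

open Filter Topology

variable {X : Type u} [TopologicalSpace X]

namespace C0

theorem eq_ofReal_of_nonneg {a : C0 X} (ha : 0 ≤ a) (t : X) : a t = ((a t).re : ℂ) :=
  Complex.ext rfl (Complex.le_def.1 (ha t)).2.symm

theorem re_nonneg {a : C0 X} (ha : 0 ≤ a) (t : X) : 0 ≤ (a t).re :=
  (Complex.le_def.1 (ha t)).1

/-- The shift by `δ` bounds the denominator below, so the quotient vanishes at infinity with `f`.
Multiplied by `a` it approximates `f` where `a` is large compared with `δ`. -/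
theorem exists_div (f : C0 X) {a : C0 X} (ha : 0 ≤ a) {δ : ℝ} (hδ : 0 < δ) :
    ∃ c : C0 X, ∀ t, c t = f t / (((a t).re + δ : ℝ) : ℂ) := by
  have hpos : ∀ t, 0 < (a t).re + δ := fun t => add_pos_of_nonneg_of_pos (re_nonneg ha t) hδ
  refine ⟨(⟨⟨fun t => f t / (((a t).re + δ : ℝ) : ℂ), ?_⟩, ?_⟩ : C₀(X, ℂ)), fun t => rfl⟩
  · have h1 := map_continuous f
    have h2 := map_continuous a
    exact h1.div (by fun_prop) fun t => Complex.ofReal_ne_zero.2 (hpos t).ne'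
  · have h0 : Tendsto (fun t => ‖f t‖ / δ) (cocompact X) (𝓝 0) := by
      simpa using (ZeroAtInftyContinuousMapClass.zero_at_infty f).norm.div_const δ
    refine squeeze_zero_norm (fun t => ?_) h0
    change ‖f t / (((a t).re + δ : ℝ) : ℂ)‖ ≤ _
    rw [norm_div, Complex.norm_real, Real.norm_of_nonneg (hpos t).le]
    gcongr
    linarith [re_nonneg ha t]

/-- A closed ideal of `C₀(X)` contains every function that vanishes where the ideal does. -/
theorem mem_of_isClosed_ideal {J : Submodule ℂ (C0 X)} (hJ : IsClosed (J : Set (C0 X)))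
    (hmul : ∀ a : C0 X, ∀ f ∈ J, a * f ∈ J) {f : C0 X} (hf : ∀ t, (∀ h ∈ J, h t = 0) → f t = 0) :
    f ∈ J := by
  rw [← SetLike.mem_coe, ← hJ.closure_eq, Metric.mem_closure_iff]
  intro ε' hε'
  obtain ⟨ε, hε, hεε'⟩ := exists_between hε'
  have hcpt : IsCompact {t | ε ≤ ‖f t‖} := by
    have h0 : ∀ᶠ t in cocompact X, ‖f t‖ < ε := by
      have := (ZeroAtInftyContinuousMapClass.zero_at_infty f).norm
      rw [norm_zero] at this
      exact this.eventually (gt_mem_nhds hε)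
    obtain ⟨K, hK, hKs⟩ := mem_cocompact.1 h0
    refine hK.of_isClosed_subset (isClosed_le continuous_const (map_continuous f).norm) ?_
    intro t ht
    by_contra h
    exact absurd (show ‖f t‖ < ε from hKs h) (not_lt.2 ht)
  -- By compactness a finite sum of functions `|h|²` with `h ∈ J` is positive wherever `f` is not
  -- small.
  obtain ⟨a, haJ, ha, haK⟩ : ∃ a ∈ J, 0 ≤ a ∧ ∀ t ∈ {t | ε ≤ ‖f t‖}, 0 < (a t).re := by
    refine hcpt.induction_on (p := fun s => ∃ a ∈ J, 0 ≤ a ∧ ∀ t ∈ s, 0 < (a t).re) ?_ ?_ ?_ ?_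
    · exact ⟨0, J.zero_mem, le_rfl, fun t ht => ht.elim⟩
    · rintro s t hst ⟨a, haJ, ha, h⟩
      exact ⟨a, haJ, ha, fun x hx => h x (hst hx)⟩
    · rintro s t ⟨a, haJ, ha, h⟩ ⟨b, hbJ, hb, h'⟩
      refine ⟨a + b, J.add_mem haJ hbJ, add_nonneg ha hb, fun x hx => ?_⟩
      rw [add_apply, Complex.add_re]
      rcases hx with hx | hx
      · exact add_pos_of_pos_of_nonneg (h x hx) (re_nonneg hb x)
      · exact add_pos_of_nonneg_of_pos (re_nonneg ha x) (h' x hx)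
    · intro t ht
      obtain ⟨h, hhJ, hht⟩ : ∃ h ∈ J, h t ≠ 0 := by
        by_contra hcon
        push Not at hcon
        have h0 : ε ≤ ‖f t‖ := ht
        rw [hf t hcon, norm_zero] at h0
        exact absurd hε (not_lt.2 h0)
      refine ⟨{s | h s ≠ 0}, mem_nhdsWithin_of_mem_nhds
        ((isOpen_ne_fun (map_continuous h) continuous_const).mem_nhds hht), star h * h,
        hmul _ _ hhJ, star_mul_self_nonneg h, fun s hs => ?_⟩
      rw [mul_apply, star_apply, Complex.star_def, ← Complex.normSq_eq_conj_mul_self,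
        Complex.ofReal_re]
      exact Complex.normSq_pos.2 hs
  obtain ⟨m, hm, hmK⟩ := hcpt.exists_forall_le'
    (Complex.continuous_re.comp (map_continuous a)).continuousOn haK
  -- The error of `f a / (a + δ)` is `f δ / (a + δ)`. On the compact set this is at most `(‖f‖ + 1)
  -- δ / m = ε`; elsewhere it is at most `|f| < ε`.
  set δ := ε * m / (‖f‖ + 1) with hδ
  have hδpos : 0 < δ := by positivity
  obtain ⟨c, hc⟩ := exists_div f ha hδpos
  refine ⟨c * a, hmul _ _ haJ, lt_of_le_of_lt ?_ hεε'⟩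
  rw [dist_eq_norm]
  refine norm_le_of_apply hε.le fun t => ?_
  have hat := re_nonneg ha t
  have hpos : 0 < (a t).re + δ := by positivity
  have hval : (f - c * a) t = f t * ((δ / ((a t).re + δ) : ℝ) : ℂ) := by
    rw [sub_apply, mul_apply, hc, eq_ofReal_of_nonneg ha t, Complex.ofReal_re]
    have : (((a t).re + δ : ℝ) : ℂ) ≠ 0 := Complex.ofReal_ne_zero.2 hpos.ne'
    rw [Complex.ofReal_div]
    field_simp
    push_cast
    ring
  rw [hval, norm_mul, Complex.norm_real, Real.norm_of_nonneg (by positivity)]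
  by_cases ht : ε ≤ ‖f t‖
  · have h1 : m ≤ (a t).re := hmK t ht
    calc ‖f t‖ * (δ / ((a t).re + δ)) ≤ (‖f‖ + 1) * (δ / m) := by
          gcongr
          · linarith [norm_apply_le f t]
          · linarith
      _ = ε := by rw [hδ]; field_simp
  · push Not at ht
    calc ‖f t‖ * (δ / ((a t).re + δ)) ≤ ‖f t‖ * 1 := by
          gcongr
          exact div_le_one_of_le₀ (by linarith) hpos.le
      _ ≤ ε := by linarith

end C0

namespace HilbMod

theorem comp_apply {E F G : HilbMod X} (f : E ⟶ F) (h : F ⟶ G) (x : E) : (f ≫ h) x = h (f x) :=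
  rfl

theorem map_smul₀ {E F : HilbMod X} (f : E ⟶ F) (a : C0 X) (x : E) : f (a • x) = a • f x :=
  Hom.map_smul₀ f a x

/-- The open mapping theorem bounds the inverse, and injectivity makes it `C₀(X)`-linear. -/
theorem isIso_of_bijective {E F : HilbMod X} (f : E ⟶ F) (hf : Function.Bijective f) :
    IsIso f := by
  let e := ContinuousLinearEquiv.ofBijective f.toContinuousLinearMap
    (LinearMap.ker_eq_bot.2 hf.1) (LinearMap.range_eq_top.2 hf.2)
  have h1 : ∀ y, f (e.symm y) = y := e.apply_symm_apply
  have h2 : ∀ x, e.symm (f x) = x := e.symm_apply_apply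
  refine ⟨⟨⟨e.symm, fun a y => hf.1 ?_⟩, Hom.ext h2, Hom.ext h1⟩⟩
  change f (e.symm (a • y)) = f (a • e.symm y)
  rw [h1, map_smul₀, h1]

theorem norm_smul_le {E : HilbMod X} (a : C0 X) (x : E) : ‖a • x‖ ≤ ‖a‖ * ‖x‖ := by
  refine le_of_sq_le_sq ?_ (by positivity)
  rw [CStarModule.norm_sq_eq (C0 X), CStarModule.inner_op_smul_right,
    CStarModule.inner_op_smul_left, mul_pow, CStarModule.norm_sq_eq (C0 X) (x := x), sq, mul_assoc]
  refine (norm_mul_le _ _).trans ?_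
  gcongr
  refine (norm_mul_le _ _).trans ?_
  rw [norm_star, mul_comm]

/-- An approximate unit for a vector, in the ideal generated by its inner square. -/
theorem exists_norm_sub_smul_lt {E : HilbMod X} (x : E) {ε : ℝ} (hε : 0 < ε) :
    ∃ c : C0 X, (∀ t, inner (C0 X) x x t = 0 → c t = 0) ∧ ‖x - c • x‖ < ε := by
  set a := inner (C0 X) x x with ha'
  have ha : 0 ≤ a := CStarModule.inner_self_nonneg
  -- With `c = a / (a + δ)` the inner square of `x - c • x` is `δ² a / (a + δ)² ≤ δ`.
  set δ := (ε / 2) ^ 2 with hδ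
  have hδpos : 0 < δ := by positivity
  obtain ⟨c, hc⟩ := C0.exists_div a ha hδpos
  refine ⟨c, fun t ht => by rw [hc, ht, zero_div], lt_of_le_of_lt ?_ (half_lt_self hε)⟩
  refine le_of_sq_le_sq ?_ (by positivity)
  rw [CStarModule.norm_sq_eq (C0 X)]
  refine C0.norm_le_of_apply hδpos.le fun t => ?_
  have hat := C0.re_nonneg ha t
  have hpos : 0 < (a t).re + δ := by positivity
  have hval : inner (C0 X) (x - c • x) (x - c • x) t =
      (((δ / ((a t).re + δ)) ^ 2 * (a t).re : ℝ) : ℂ) := by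
    simp only [CStarModule.inner_sub_left, CStarModule.inner_sub_right,
      CStarModule.inner_op_smul_left, CStarModule.inner_op_smul_right, C0.sub_apply,
      C0.mul_apply, C0.star_apply, hc, ← ha']
    rw [C0.eq_ofReal_of_nonneg ha t, Complex.ofReal_re, Complex.star_def, map_div₀,
      Complex.conj_ofReal, Complex.conj_ofReal]
    have : (((a t).re + δ : ℝ) : ℂ) ≠ 0 := Complex.ofReal_ne_zero.2 hpos.ne'
    push_cast at this ⊢
    field_simp
    ring
  rw [hval, Complex.norm_real, Real.norm_of_nonneg (by positivity), div_pow, div_mul_eq_mul_div,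
    div_le_iff₀ (by positivity)]
  nlinarith [mul_nonneg hδpos.le (sq_nonneg (a t).re), mul_nonneg hδpos.le (sq_nonneg δ),
    mul_nonneg hδpos.le (mul_nonneg hδpos.le hat)]

/-! ### Supports -/

/-- The map `f ↦ f • x` on the ideal of functions that vanish outside `U`. -/
noncomputable def smulHom {E : HilbMod X} (U : Set X) (x : E) : idealObj U ⟶ E where
  toContinuousLinearMap := LinearMap.mkContinuous
    { toFun := fun f : vanishing U => f.1 • x
      map_add' := fun f g => E.ext_inner fun z => by
        change inner (C0 X) z ((f.1 + g.1) • x) = _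
        simp [add_mul]
      map_smul' := fun c f => E.ext_inner fun z => by
        change inner (C0 X) z ((c • f.1) • x) = _
        simp [smul_mul_assoc] } ‖x‖
    fun f => (norm_smul_le f.1 x).trans_eq (mul_comm _ _)
  map_smul₀ a f := E.ext_inner fun z => by
    change inner (C0 X) z ((a * f.1) • x) = inner (C0 X) z (a • f.1 • x)
    simp [mul_assoc]

theorem smulHom_apply {E : HilbMod X} (U : Set X) (x : E) (f : idealObj U) :
    smulHom U x f = (show vanishing U from f).1 • x := rfl

/-- A map into `C₀(X)` whose values vanish outside `U` factors through `C₀(U)`. -/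
noncomputable def codRestrict {E : HilbMod X} (U : Set X) (f : E ⟶ tensorUnit X)
    (hf : ∀ x, ∀ t ∉ U, (show C0 X from f x) t = 0) : E ⟶ idealObj U where
  toContinuousLinearMap := f.toContinuousLinearMap.codRestrict (vanishing U) hf
  map_smul₀ a x := Subtype.ext (f.map_smul₀ a x)

theorem codRestrict_comp {E : HilbMod X} (U : Set X) (f : E ⟶ tensorUnit X)
    (hf : ∀ x, ∀ t ∉ U, (show C0 X from f x) t = 0) : codRestrict U f hf ≫ idealIncl U = f :=
  Hom.ext fun _ => rfl

theorem mem_support_mk {E : HilbMod X} (f : E ⟶ tensorUnit X) [Mono f] {t : X} :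
    t ∈ support (Subobject.mk f) ↔ ∃ x : E, (show C0 X from f x) t ≠ 0 := by
  constructor
  · rintro ⟨x, hx⟩
    refine ⟨(Subobject.underlyingIso f).hom x, ?_⟩
    rwa [← comp_apply, Subobject.underlyingIso_hom_comp_eq_mk]
  · rintro ⟨x, hx⟩
    refine ⟨(Subobject.underlyingIso f).inv x, ?_⟩
    rwa [← comp_apply, Subobject.underlyingIso_arrow]

theorem isOpen_support (s : Subobject (tensorUnit X)) : IsOpen (support s) := by
  have : support s = ⋃ x : (s : HilbMod X), {t | (show C0 X from s.arrow x) t ≠ 0} := by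
    ext; simp [support]
  rw [this]
  exact isOpen_iUnion fun x => isOpen_ne_fun (map_continuous (show C0 X from s.arrow x))
    continuous_const

theorem support_mono {s t : Subobject (tensorUnit X)} (h : s ≤ t) : support s ⊆ support t := by
  rintro p ⟨x, hx⟩
  refine ⟨Subobject.ofLE s t h x, ?_⟩
  rwa [← comp_apply, Subobject.ofLE_arrow]

theorem le_subunitOf {s : Subobject (tensorUnit X)} {U : Set X} (h : support s ⊆ U) :
    s ≤ subunitOf U :=
  Subobject.le_mk_of_comm (codRestrict U s.arrow fun x t ht => by
    by_contra hx
    exact ht (h ⟨x, hx⟩)) (codRestrict_comp _ _ _)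

theorem support_subunitOf_subset (U : Set X) : support (subunitOf U) ⊆ U := fun t ht => by
  obtain ⟨x, hx⟩ := (mem_support_mk _).1 ht
  by_contra h
  exact hx ((show vanishing U from x).2 t h)

/-- Urysohn's lemma with compact support; the place where local compactness and the Hausdorff
property enter. -/
theorem exists_C0_ne_zero [T2Space X] [LocallyCompactSpace X] {U : Set X} (hU : IsOpen U) {t : X}
    (ht : t ∈ U) : ∃ f ∈ vanishing U, f t ≠ 0 := by
  obtain ⟨f, hf1, hf0, hfc, -⟩ := exists_continuous_one_zero_of_isCompact
    (isCompact_singleton (x := t)) hU.isClosed_compl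
    (Set.disjoint_compl_right_iff_subset.2 (Set.singleton_subset_iff.2 ht))
  let g : C(X, ℂ) := ⟨fun s => (f s : ℂ), by fun_prop⟩
  have hg : HasCompactSupport g := hfc.comp_left Complex.ofReal_zero
  refine ⟨(⟨g, hg.is_zero_at_infty⟩ : C₀(X, ℂ)), fun s hs => ?_, ?_⟩
  · change ((f s : ℝ) : ℂ) = 0
    rw [hf0 hs]; rfl
  · change ((f t : ℝ) : ℂ) ≠ 0
    rw [hf1 rfl]; simp

theorem support_subunitOf [T2Space X] [LocallyCompactSpace X] {U : Set X} (hU : IsOpen U) :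
    support (subunitOf U) = U := by
  refine (support_subunitOf_subset U).antisymm fun t ht => ?_
  obtain ⟨f, hf, hft⟩ := exists_C0_ne_zero hU ht
  exact (mem_support_mk _).2 ⟨(⟨f, hf⟩ : vanishing U), hft⟩

theorem eq_bot_iff_support {s : Subobject (tensorUnit X)} : s = ⊥ ↔ support s = ∅ := by
  have h : subunitOf (∅ : Set X) = ⊥ := by
    refine le_bot_iff.1 (Subobject.mk_le_mk_of_comm (smulHom ∅ 0) (Hom.ext fun x => ?_))
    have hx : x = 0 := Subtype.ext (C0.ext fun t => (show vanishing ∅ from x).2 t id)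
    rw [hx]
    exact (map_zero (Hom.toContinuousLinearMap _)).trans
      (map_zero (Hom.toContinuousLinearMap _)).symm
  constructor
  · rintro rfl
    rw [← h]
    exact Set.subset_empty_iff.1 (support_subunitOf_subset ∅)
  · intro hs
    exact le_bot_iff.1 (h ▸ le_subunitOf hs.le)

/-- If `a = s(x)` and `b = t(y)` are both nonzero at `p`, multiplication by `ab` on functions
supported in `{ab ≠ 0}` is monic and factors through `s` (via `b • x`) and through `t` (via `a •
y`). It is nonzero at `p`, although the images need not be closed ideals. -/
theorem disjoint_iff_support {s t : Subobject (tensorUnit X)} :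
    Disjoint s t ↔ Disjoint (support s) (support t) := by
  constructor
  · intro h
    rw [Set.disjoint_left]
    rintro p ⟨x, hx⟩ ⟨y, hy⟩
    set a : C0 X := s.arrow x with ha
    set b : C0 X := t.arrow y with hb
    set U : Set X := {q | a q ≠ 0 ∧ b q ≠ 0} with hU
    let f : idealObj U ⟶ tensorUnit X := smulHom (E := tensorUnit X) U (b * a : C0 X)
    have hf : ∀ (c : idealObj U) (q : X), (show C0 X from f c) q =
        (show vanishing U from c).1 q * (b q * a q) := fun c q => rfl
    have : Mono f := mono_of_injective f fun c d hcd => Subtype.ext (C0.ext fun q => by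
      by_cases hq : q ∈ U
      · have := DFunLike.congr_fun (show (show C0 X from f c) = (show C0 X from f d) from hcd) q
        rw [hf, hf] at this
        exact mul_right_cancel₀ (mul_ne_zero hq.2 hq.1) this
      · rw [c.2 q hq, d.2 q hq])
    have hs : Subobject.mk f ≤ s := Subobject.mk_le_of_comm (smulHom U (b • x)) (Hom.ext fun c => by
      rw [comp_apply, smulHom_apply, map_smul₀, map_smul₀]
      rfl)
    have ht : Subobject.mk f ≤ t := Subobject.mk_le_of_comm (smulHom U (a • y)) (Hom.ext fun c => by
      rw [comp_apply, smulHom_apply, map_smul₀, map_smul₀]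
      change (show vanishing U from c).1 * (a * b) = (show vanishing U from c).1 * (b * a)
      rw [mul_comm a b])
    have hbot := eq_bot_iff_support.1 (le_bot_iff.1 (h hs ht))
    have hp : p ∈ support (Subobject.mk f) := by
      refine (mem_support_mk f).2 ⟨(⟨a * b, fun q hq => ?_⟩ : vanishing U), ?_⟩
      · by_contra hne
        exact hq ⟨left_ne_zero_of_mul hne, right_ne_zero_of_mul hne⟩
      · refine (hf _ p).trans_ne ?_
        exact mul_ne_zero (mul_ne_zero hx hy) (mul_ne_zero hy hx)
    rw [hbot] at hp
    exact hp
  · intro h r hs ht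
    refine (eq_bot_iff_support.2 ?_).le
    exact Set.subset_empty_iff.1 (h (support_mono hs) (support_mono ht))

end HilbMod
end Subunits

/-! ### Idempotent subunits are the ideals of functions vanishing outside an open set -/

section IdempotentSubunits

open UniformSpace Filter Topology

variable {X : Type u} [TopologicalSpace X]

namespace HilbMod

/-- Bounded maps on a tensor product are determined by their values on elementary tensors. -/
theorem tensor_hom_ext {E F G : HilbMod X} {f g : tensorObj E F ⟶ G}
    (h : ∀ x y, f (tmul x y) = g (tmul x y)) : f = g := by
  refine Hom.ext fun z => ?_
  refine Completion.induction_on (p := fun z : Completion (PreTensor E F) => f z = g z) z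
    (isClosed_eq f.toContinuousLinearMap.continuous g.toContinuousLinearMap.continuous) fun z => ?_
  induction z using PreTensor.induction with
  | h x y => exact h x y
  | hadd z w hz hw =>
    rw [Completion.coe_add]
    exact (map_add f.toContinuousLinearMap _ _).trans
      ((congrArg₂ (· + ·) hz hw).trans (map_add g.toContinuousLinearMap _ _).symm)

theorem whiskerRight_comp {E F G : HilbMod X} (f : E ⟶ F) (g : F ⟶ G) (H : HilbMod X) :
    whiskerRight (f ≫ g) H = whiskerRight f H ≫ whiskerRight g H :=
  tensor_hom_ext fun x y => by
    rw [comp_apply, whiskerRight_tmul, whiskerRight_tmul, whiskerRight_tmul, comp_apply]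

theorem whiskerRight_id (E H : HilbMod X) : whiskerRight (𝟙 E) H = 𝟙 (tensorObj E H) :=
  tensor_hom_ext fun x y => by
    rw [whiskerRight_tmul]; rfl

instance {E F : HilbMod X} (f : E ⟶ F) [IsIso f] (H : HilbMod X) : IsIso (whiskerRight f H) :=
  ⟨whiskerRight (inv f) H, by rw [← whiskerRight_comp, IsIso.hom_inv_id, whiskerRight_id],
    by rw [← whiskerRight_comp, IsIso.inv_hom_id, whiskerRight_id]⟩

theorem norm_tmul_le {E F : HilbMod X} (x : E) (y : F) : ‖tmul x y‖ ≤ ‖x‖ * ‖y‖ := by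
  refine le_of_sq_le_sq ?_ (by positivity)
  rw [CStarModule.norm_sq_eq (C0 X), inner_tmul, mul_pow, CStarModule.norm_sq_eq (C0 X) (x := x),
    CStarModule.norm_sq_eq (C0 X) (x := y)]
  exact norm_mul_le _ _

theorem tmul_sub {E F : HilbMod X} (x : E) (y y' : F) :
    tmul x (y - y') = tmul x y - tmul x y' := by
  rw [tmul, map_sub, Completion.coe_sub]; rfl

/-- The inclusion of an ideal preserves inner products, up to the order of the factors, and so does
its tensor product with `id`. -/
theorem form_mapLeft_idealIncl (U : Set X) (G : HilbMod X) (z w : PreTensor (idealObj U) G) :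
    PreTensor.form _ G (PreTensor.mapLeft (idealIncl U) G z)
      (PreTensor.mapLeft (idealIncl U) G w) = PreTensor.form _ G z w := by
  induction z using PreTensor.induction with
  | hadd z z' hz hz' => simp only [map_add, LinearMap.add_apply, hz, hz']
  | h x y =>
    induction w using PreTensor.induction with
    | hadd z z' hz hz' => simp only [map_add, hz, hz']
    | h x' y' =>
      rw [PreTensor.mapLeft_tmul, PreTensor.mapLeft_tmul, PreTensor.form_tmul,
        PreTensor.form_tmul]
      exact congrArg (· * _) (mul_comm _ _)

theorem norm_whiskerRight_idealIncl (U : Set X) (G : HilbMod X) (z : tensorObj (idealObj U) G) :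
    ‖whiskerRight (idealIncl U) G z‖ = ‖z‖ := by
  refine Completion.induction_on (p := fun z : Completion (PreTensor (idealObj U) G) =>
    ‖whiskerRight (idealIncl U) G z‖ = ‖z‖) z (isClosed_eq
      (whiskerRight (idealIncl U) G).toContinuousLinearMap.continuous.norm continuous_norm)
      fun z => ?_
  have h : whiskerRight (idealIncl U) G (z : Completion (PreTensor (idealObj U) G)) =
      ((PreTensor.mapLeft (idealIncl U) G z : PreTensor (tensorUnit X) G) :
        Completion (PreTensor (tensorUnit X) G)) :=
    ContinuousLinearMap.completion_apply_coe (PreTensor.mapLeftL (idealIncl U) G) z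
  rw [h]
  refine (Completion.norm_coe _).trans (Eq.trans ?_ (Completion.norm_coe z).symm)
  change √‖PreTensor.form _ _ _ _‖ = √‖PreTensor.form _ _ _ _‖
  rw [form_mapLeft_idealIncl]

/-- An isometry has closed range, so it suffices to approximate `a ⊗ y`. By `hG` the approximate
unit `c` of `y` vanishes outside `U`, and `a ⊗ (c • y) = (a c) ⊗ y` lies in the range. -/
theorem isIso_whiskerRight_idealIncl (U : Set X) (G : HilbMod X)
    (hG : ∀ y : G, ∀ t ∉ U, inner (C0 X) y y t = 0) : IsIso (whiskerRight (idealIncl U) G) := by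
  set f := whiskerRight (idealIncl U) G with hf
  set L := f.toContinuousLinearMap with hL
  have hiso : Isometry L :=
    AddMonoidHomClass.isometry_of_norm L (norm_whiskerRight_idealIncl U G)
  refine isIso_of_bijective f ⟨hiso.injective, ?_⟩
  have hcl : IsClosed (L.range : Set (tensorObj (tensorUnit X) G)) :=
    hiso.isClosedEmbedding.isClosed_range
  have htmul : ∀ (a : tensorUnit X) (y : G), tmul a y ∈ L.range := by
    intro a y
    rw [← SetLike.mem_coe, ← hcl.closure_eq, Metric.mem_closure_iff]
    intro ε hε
    obtain ⟨c, hc, hcy⟩ := exists_norm_sub_smul_lt y (ε := ε / (‖a‖ + 1)) (by positivity)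
    have hcU : c ∈ vanishing U := fun t ht => hc t (hG y t ht)
    let c' : idealObj U := (⟨c, hcU⟩ : vanishing U)
    refine ⟨tmul a (c • y), ⟨tmul ((show C0 X from a) • c') y, ?_⟩, ?_⟩
    · refine (whiskerRight_tmul (idealIncl U) _ y).trans ?_
      rw [← tmul_smul]
      exact congrArg (tmul · y) (mul_comm (show C0 X from a) c)
    · rw [dist_eq_norm, ← tmul_sub]
      refine (norm_tmul_le _ _).trans_lt ?_
      rw [lt_div_iff₀ (by positivity)] at hcy
      refine lt_of_le_of_lt ?_ hcy
      rw [mul_comm]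
      gcongr
      exact (le_add_of_nonneg_right zero_le_one : ‖a‖ ≤ ‖a‖ + 1)
  intro z
  refine Completion.induction_on (p := fun z : Completion (PreTensor (tensorUnit X) G) =>
    z ∈ L.range) z hcl fun z => ?_
  induction z using PreTensor.induction with
  | h x y => exact htmul x y
  | hadd z w hz hw =>
    rw [Completion.coe_add]
    exact L.range.add_mem hz hw

/-- An isomorphism need not preserve inner products, but the pointwise bound `inner_map_le` carries
their vanishing outside `U` from `idealObj U` over to `S`. -/
theorem isIso_whiskerRight_comp_idealIncl {U : Set X} {S : HilbMod X} (e : S ≅ idealObj U) :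
    IsIso (whiskerRight (e.hom ≫ idealIncl U) S) := by
  have := isIso_whiskerRight_idealIncl U S fun y t ht => by
    have h1 : e.inv (e.hom y) = y := by rw [← comp_apply, e.hom_inv_id]; rfl
    have h2 := inner_map_le e.inv t (e.hom y)
    have h3 : inner (C0 X) (e.hom y) (e.hom y) t = 0 := by
      change star ((show vanishing U from e.hom y).1 t) * (show vanishing U from e.hom y).1 t = 0
      rw [(show vanishing U from e.hom y).2 t ht, mul_zero]
    have h0 : (0 : C0 X) ≤ inner (C0 X) y y := CStarModule.inner_self_nonneg
    rw [h1, h3, Complex.zero_re, mul_zero] at h2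
    rw [C0.eq_ofReal_of_nonneg h0, le_antisymm h2 (C0.re_nonneg h0 t), Complex.ofReal_zero]
  rw [whiskerRight_comp]
  infer_instance

theorem isIdempotent_subunitOf (U : Set X) : IsIdempotent (subunitOf U) := by
  have he : (subunitOf U).arrow = (Subobject.underlyingIso (idealIncl U)).hom ≫ idealIncl U :=
    (Subobject.underlyingIso_hom_comp_eq_mk _).symm
  rw [IsIdempotent, he]
  exact isIso_whiskerRight_comp_idealIncl _

/-- Bounding the inverse of `s ⊗ id` pointwise at `s(x) ⊗ x` gives `p² ≤ K² |s(x)|² p` with `p = ⟪x,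
x⟫(t)`; where `p ≠ 0` it cancels, and where `p = 0` there is nothing to show. -/
theorem IsIdempotent.exists_norm_le {s : Subobject (tensorUnit X)} (hs : IsIdempotent s) :
    ∃ K : ℝ, 0 ≤ K ∧ ∀ x : (s : HilbMod X), ‖x‖ ≤ K * ‖s.arrow x‖ := by
  have : IsIso (whiskerRight s.arrow (s : HilbMod X)) := hs
  set f := whiskerRight s.arrow (s : HilbMod X) with hf
  set K := ‖(inv f).toContinuousLinearMap‖ with hK
  have hK0 : 0 ≤ K := norm_nonneg _
  refine ⟨K, hK0, fun x => le_of_sq_le_sq ?_ (by positivity)⟩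
  rw [CStarModule.norm_sq_eq (C0 X)]
  refine C0.norm_le_of_apply (by positivity) fun t => ?_
  have h0 : (0 : C0 X) ≤ inner (C0 X) x x := CStarModule.inner_self_nonneg
  set a : C0 X := s.arrow x with ha
  have h1 := inner_map_le (inv f) t (f (tmul x x))
  have h2 : (inv f) (f (tmul x x)) = tmul x x := by
    rw [← comp_apply, IsIso.hom_inv_id]; rfl
  have h4 : f (tmul x x) = tmul (s.arrow x) x := whiskerRight_tmul _ _ _
  have h3 : inner (C0 X) (s.arrow x) (s.arrow x) = star a * a := mul_comm a (star a)
  rw [h2, h4, inner_tmul, inner_tmul, h3, C0.mul_apply, C0.mul_apply,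
    C0.mul_apply, C0.star_apply, C0.eq_ofReal_of_nonneg h0 t, Complex.star_def,
    ← Complex.normSq_eq_conj_mul_self, ← Complex.ofReal_mul, ← Complex.ofReal_mul,
    Complex.ofReal_re, Complex.ofReal_re, Complex.normSq_eq_norm_sq, ← hK] at h1
  rw [C0.eq_ofReal_of_nonneg h0 t, Complex.norm_real, Real.norm_of_nonneg (C0.re_nonneg h0 t)]
  have hp := C0.re_nonneg h0 t
  have ht : ‖a t‖ ^ 2 ≤ ‖s.arrow x‖ ^ 2 := by
    gcongr
    exact C0.norm_apply_le a t
  rw [mul_pow]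
  refine le_trans ?_ (mul_le_mul_of_nonneg_left ht (sq_nonneg K))
  rcases hp.eq_or_lt with hp | hp
  · rw [← hp]; positivity
  · exact le_of_mul_le_mul_right (by linarith) hp

/-- An idempotent subunit is the ideal of functions that vanish outside its support. -/
theorem IsIdempotent.eq_subunitOf {s : Subobject (tensorUnit X)} (hs : IsIdempotent s) :
    s = subunitOf (support s) := by
  refine (le_subunitOf subset_rfl).antisymm ?_
  obtain ⟨K, hK, hle⟩ := hs.exists_norm_le
  set L := s.arrow.toContinuousLinearMap with hL
  have hanti : AntilipschitzWith ⟨K, hK⟩ L :=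
    AddMonoidHomClass.antilipschitz_of_bound L hle
  let J : Submodule ℂ (C0 X) := L.range
  -- A map bounded below on a complete space has closed range; the ideal theorem then identifies
  -- that range.
  have hJ : IsClosed (J : Set (C0 X)) := hanti.isClosed_range L.uniformContinuous
  set f := codRestrict (support s) s.arrow fun x t ht => by
    by_contra hx
    exact ht ⟨x, hx⟩ with hf
  have hcomp : f ≫ idealIncl (support s) = s.arrow := codRestrict_comp _ _ _
  have hbij : Function.Bijective f := by
    refine ⟨fun x y hxy => hanti.injective (congrArg Subtype.val hxy), fun y => ?_⟩
    obtain ⟨x, hx⟩ : (show vanishing (support s) from y).1 ∈ J := by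
      refine C0.mem_of_isClosed_ideal hJ ?_ fun t ht => ?_
      · rintro a _ ⟨x, rfl⟩
        exact ⟨a • x, map_smul₀ s.arrow a x⟩
      · refine (show vanishing (support s) from y).2 t ?_
        rintro ⟨x, hx⟩
        exact hx (ht _ ⟨x, rfl⟩)
    exact ⟨x, Subtype.ext hx⟩
  have := isIso_of_bijective f hbij
  exact Subobject.mk_le_of_comm (inv f) (by rw [← hcomp, IsIso.inv_hom_id_assoc])

end HilbMod

/-! ### Closure operators and complements on idempotent subunits -/

namespace IdempotentSubunit

open HilbMod

/-- The idempotent subunit `C₀(U)`. -/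
noncomputable def of (U : Set X) : IdempotentSubunit X := ⟨subunitOf U, isIdempotent_subunitOf U⟩

/-- Idempotency of `t` makes it the largest subunit with its support. -/
theorem le_iff {s t : IdempotentSubunit X} : s ≤ t ↔ support s.1 ⊆ support t.1 := by
  refine ⟨fun h => support_mono h, fun h => ?_⟩
  change s.1 ≤ t.1
  rw [t.2.eq_subunitOf]
  exact le_subunitOf h

theorem ext_support {s t : IdempotentSubunit X} (h : support s.1 = support t.1) : s = t :=
  le_antisymm (le_iff.2 h.le) (le_iff.2 h.ge)

variable [T2Space X] [LocallyCompactSpace X]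

theorem support_of {U : Set X} (hU : IsOpen U) : support (of U).1 = U := support_subunitOf hU

/-- The closure operator `s ↦ C₀(I⁺(supp s))` of a chronological relation. -/
noncomputable def closureOperator {R : X → X → Prop} (h : IsChronological R) :
    ClosureOperator (IdempotentSubunit X) :=
  ClosureOperator.mk' (fun s => of (relFuture R (support s.1)))
    (fun s t hst => le_iff.2 <| by
      rw [support_of (h.isOpen_relFuture _), support_of (h.isOpen_relFuture _)]
      exact fun q hq => hq.imp fun p hp => ⟨le_iff.1 hst hp.1, hp.2⟩)
    (fun s => le_iff.2 <| by
      rw [support_of (h.isOpen_relFuture _)]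
      exact h.subset_relFuture (isOpen_support _))
    (fun s => le_iff.2 <| by
      rw [support_of (h.isOpen_relFuture _), support_of (h.isOpen_relFuture _),
        h.relFuture_relFuture])

theorem isClosed_closureOperator_iff {R : X → X → Prop} (h : IsChronological R)
    {s : IdempotentSubunit X} :
    (closureOperator h).IsClosed s ↔ relFuture R (support s.1) = support s.1 := by
  rw [ClosureOperator.isClosed_iff]
  have : support (closureOperator h s).1 = relFuture R (support s.1) :=
    support_of (h.isOpen_relFuture _)
  rw [← this]
  exact ⟨congrArg fun t : IdempotentSubunit X => support t.1, ext_support⟩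

/-- Through supports this is `relFuture_swap_compl_closure` for existence and `eq_compl_closure` for
uniqueness. -/
theorem exists_complement {R : X → X → Prop} (h : IsChronological R)
    {s : IdempotentSubunit X} (hs : (closureOperator h).IsClosed s) :
    ∃ t : IdempotentSubunit X, (closureOperator h.swap).IsClosed t ∧
      t.1 = subunitOf (closure (support s.1))ᶜ ∧ Disjoint s.1 t.1 ∧
      (∀ r : Subobject (tensorUnit X), Disjoint r s.1 → Disjoint r t.1 → r = ⊥) ∧
      ∀ t' : IdempotentSubunit X, (closureOperator h.swap).IsClosed t' → Disjoint s.1 t'.1 →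
        (∀ r : IdempotentSubunit X, Disjoint r.1 s.1 → Disjoint r.1 t'.1 → r.1 = ⊥) → t' = t := by
  rw [isClosed_closureOperator_iff] at hs
  have hsupp : support (of (closure (support s.1))ᶜ).1 = (closure (support s.1))ᶜ :=
    support_of isClosed_closure.isOpen_compl
  refine ⟨of (closure (support s.1))ᶜ, ?_, rfl, ?_, fun r hr hr' => ?_, fun t' ht' hd hr => ?_⟩
  · rw [isClosed_closureOperator_iff, hsupp]
    exact h.relFuture_swap_compl_closure hs
  · rw [disjoint_iff_support, hsupp]
    exact Set.disjoint_compl_right_iff_subset.2 subset_closure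
  · rw [disjoint_iff_support] at hr hr'
    rw [hsupp, Set.disjoint_compl_right_iff_subset] at hr'
    -- The support of `r` is open, hence also disjoint from the closure that contains it, hence
    -- empty.
    have := hr.closure_right (isOpen_support r)
    exact eq_bot_iff_support.2 (disjoint_self.1 (this.mono_right hr'))
  · rw [isClosed_closureOperator_iff] at ht'
    rw [disjoint_iff_support] at hd
    refine ext_support ((h.eq_compl_closure (isOpen_support _) ht' hd ?_).trans hsupp.symm)
    rw [dense_iff_closure_eq, ← Set.compl_empty_iff]
    have hopen : IsOpen (closure (support s.1 ∪ support t'.1))ᶜ := isClosed_closure.isOpen_compl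
    have hdis : Disjoint (closure (support s.1 ∪ support t'.1))ᶜ (support s.1 ∪ support t'.1) :=
      Set.disjoint_compl_left_iff_subset.2 subset_closure
    rw [Set.disjoint_union_right] at hdis
    -- The exterior of the union is open, so an idempotent `r` already detects any failure of
    -- density.
    have := hr (of (closure (support s.1 ∪ support t'.1))ᶜ)
      (by rw [disjoint_iff_support, support_of hopen]; exact hdis.1)
      (by rw [disjoint_iff_support, support_of hopen]; exact hdis.2)
    rw [eq_bot_iff_support, support_of hopen] at this
    exact this

end IdempotentSubunit

end IdempotentSubunits

theorem mainTheorem12 {n : ℕ} {X : Type u} [TopologicalSpace X] [T2Space X]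
    [ChartedSpace (EuclideanSpace ℝ (Fin n)) X] [IsManifold (𝓡 n) ∞ X]
    (g : LorentzMetric n X) (T : TimeOrientation g) :
    ∃ C : CausalStructure X,
      -- the closure operators `I⁺` and `I⁻` on the idempotent subunits
      (∀ s : IdempotentSubunit X,
        (C.future s).1 = HilbMod.subunitOf (T.chronFuture (HilbMod.support s.1))) ∧
      (∀ s : IdempotentSubunit X,
        (C.past s).1 = HilbMod.subunitOf (T.chronPast (HilbMod.support s.1))) ∧
      -- `I⁺`-closed subunits have unique `I⁻`-closed complements
      (∀ s : IdempotentSubunit X, C.future.IsClosed s →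
        ∃ t : IdempotentSubunit X, C.past.IsClosed t ∧
          t.1 = HilbMod.subunitOf (closure (HilbMod.support s.1))ᶜ ∧
          Disjoint s.1 t.1 ∧
          (∀ r : Subobject (HilbMod.tensorUnit X), Disjoint r s.1 → Disjoint r t.1 → r = ⊥) ∧
          ∀ t' : IdempotentSubunit X, C.past.IsClosed t' → Disjoint s.1 t'.1 →
            (∀ r : IdempotentSubunit X, Disjoint r.1 s.1 → Disjoint r.1 t'.1 → r.1 = ⊥) →
            t' = t) ∧
      -- `I⁻`-closed subunits have unique `I⁺`-closed complements
      (∀ s : IdempotentSubunit X, C.past.IsClosed s →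
        ∃ t : IdempotentSubunit X, C.future.IsClosed t ∧
          t.1 = HilbMod.subunitOf (closure (HilbMod.support s.1))ᶜ ∧
          Disjoint s.1 t.1 ∧
          (∀ r : Subobject (HilbMod.tensorUnit X), Disjoint r s.1 → Disjoint r t.1 → r = ⊥) ∧
          ∀ t' : IdempotentSubunit X, C.future.IsClosed t' → Disjoint s.1 t'.1 →
            (∀ r : IdempotentSubunit X, Disjoint r.1 s.1 → Disjoint r.1 t'.1 → r.1 = ⊥) →
            t' = t) := by
  have : LocallyCompactSpace X := ChartedSpace.locallyCompactSpace (EuclideanSpace ℝ (Fin n)) X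
  have h := T.isChronological
  -- The past is the future of the reversed relation, so one construction serves both directions.
  exact ⟨⟨IdempotentSubunit.closureOperator h, IdempotentSubunit.closureOperator h.swap⟩,
    fun _ => rfl, fun _ => rfl, fun _ hs => IdempotentSubunit.exists_complement h hs,
    fun _ hs => IdempotentSubunit.exists_complement h.swap hs⟩
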